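/- Let $p\ge 5$ be a prime number, let $\mathcal K$ be a complete non-Archimedean valued field of characteristic $p$ with absolute value $|\cdot|$, and let $\lambda\in\mathcal K$ be an element that is not a root of unity and satisfies $|1-\lambda|<1$. Let $a_1,a_2\in\mathcal K$ with $$a_1\neq 0,\qquad \left|1-\frac{a_2}{a_1^2}\right|\ge 1\qquad\text{and}\qquad \left|1-\frac{a_2}{a_1^2}\right|\neq\frac{1}{|1-\lambda|}.$$ Then the polynomial $f(z)=\lambda z+a_1z^2+a_2z^3\in\mathcal K[z]$ is non-linearizable at $z=0$; that is, there is no power series $h(z)=z\sum_{n\ge 0}b_nz^n\in\mathcal K[\![z]\!]$ with $b_0\neq 0$ which converges on some open disc of positive radius around $0$ and satisfies $h\circ f\circ h^{-1}(z)=\lambda z$, where $h^{-1}$ is the inverse of $h$ for composition. -/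

import Mathlib

/-- A formal power series over a normed field is locally analytic at `z = 0` if it converges at
every point of some open ball of positive radius centred at `0`. -/
def IsLocallyAnalytic {K : Type*} [NormedField K] (f : PowerSeries K) : Prop :=
  ∃ r : ℝ, 0 < r ∧ ∀ z : K, ‖z‖ < r → Summable (fun n : ℕ => PowerSeries.coeff n f * z ^ n)

/-- A power series `f(z) = z (lam + a₁ z + ...)` is locally linearizable at `z = 0` if there is a
locally analytic power series `h(z) = z (b₀ + b₁ z + ...)`, invertible for composition
(that is, `b₀ ≠ 0`), such that `h ∘ f ∘ h⁻¹ (z) = lam z`.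

In Mathlib, `h.subst f` is the composition `h ∘ f`, and `h.substInvOfIsUnit hb` is the
compositional inverse `h⁻¹` of `h`. -/
def IsLocallyLinearizable {K : Type*} [NormedField K] (f : PowerSeries K) : Prop :=
  ∃ (h : PowerSeries K) (hb : IsUnit (PowerSeries.coeff 1 h)),
    PowerSeries.constantCoeff h = 0 ∧ IsLocallyAnalytic h ∧
      PowerSeries.subst (h.substInvOfIsUnit hb) (PowerSeries.subst f h) =
        PowerSeries.C (PowerSeries.coeff 1 f) * PowerSeries.X

/-! Write `lam = 1 + ε`, `a₁ = ε α`, `a₂ = ε β`, so that `f` is `z` plus `ε` times the vector field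
`z (1 + α z + β z²)`. In a suitable coordinate `f` becomes `T = L X (1 + r)` with `L = lam` and `r`
small, and a convergent linearization becomes `b X u` with `u(T) (1 + r) = u` and `‖u_k‖ ≤ D ^ k`.
The divisors `L ^ k - 1` have size `‖ε‖` unless `p ∣ k`, so the obstruction sits in degrees
divisible by `p`.

The main device is a renormalization (`exists_renormalization`). For an equation `u(T) (1 + g) = u`,
factor `u = v * U(X ^ p)` with `v` free of positive degrees divisible by `p`. Then `U` solves an
equation of the same form with `L ^ p`, the Frobenius twist of `r`, and a new series `G`. To first
order `G(X ^ p) = g + ε X v' / v`, and the coefficients of a logarithmic derivative satisfy `l_{pn}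
= l_n ^ p` (`isCartierFixed_logDeriv`). So a dominant coefficient of `g` in degree 1 or 2 reappears
in `G` in the same degree with the factor `‖ε‖`, whereas the new multiplier is at distance only `‖ε‖
^ p` from 1. The scale `V` therefore grows faster than `V ↦ V ^ p` (`IsRenormState.step`), while the
bound on `u` caps it by `D ^ (p ^ n)` after `n` steps (`IsRenormState.le`). This is the
contradiction in `IsRenormState.false`.

To start the process, `false_of_dominant_resonance` needs a coefficient of `r` of maximal size in
degree `p` or `2 p`. Put `R = ‖1 - a₂ / a₁²‖`. If `‖ε‖ R < 1`, the coordinate `X / (1 - α X)`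
produces `ε α^(p-2) (β - ε α²)` in degree `p`, whose norm is given by `R`. If `‖ε‖ R > 1`, then `β`
dominates and the coordinate is `X / √(1 - β X²)`. The excluded equality `‖ε‖ R = 1` is the border
between these regimes. -/

/-! ### Logarithmic derivatives in characteristic `p` -/

namespace PowerSeries

section LogDeriv

variable {K : Type*} [Field K]

/-- The logarithmic derivative `X * a' / a`. -/
noncomputable def logDeriv (a : PowerSeries K) : PowerSeries K :=
  X * derivative K a * a⁻¹

lemma coeff_X_mul_derivative (a : PowerSeries K) (k : ℕ) :
    coeff k (X * derivative K a) = (k : K) * coeff k a := by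
  cases k with
  | zero => simp
  | succ n => rw [coeff_succ_X_mul, coeff_derivative]; push_cast; ring

lemma logDeriv_mul {a b : PowerSeries K} (ha : constantCoeff a = 1) (hb : constantCoeff b = 1) :
    logDeriv (a * b) = logDeriv a + logDeriv b := by
  have h1 : a * a⁻¹ = 1 := PowerSeries.mul_inv_cancel a (by simp [ha])
  have h2 : b * b⁻¹ = 1 := PowerSeries.mul_inv_cancel b (by simp [hb])
  simp only [logDeriv, PowerSeries.mul_inv_rev, Derivation.leibniz, smul_eq_mul]
  linear_combination (X * derivative K b * b⁻¹) * h1 + (X * derivative K a * a⁻¹) * h2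

/-- The Cartier relation `coeff (p * n) = (coeff n) ^ p`, which logarithmic derivatives satisfy. -/
def IsCartierFixed (p : ℕ) (l : PowerSeries K) : Prop :=
  ∀ n, coeff (p * n) l = coeff n l ^ p

lemma IsCartierFixed.add {p : ℕ} [Fact p.Prime] [CharP K p] {l m : PowerSeries K}
    (hl : IsCartierFixed p l) (hm : IsCartierFixed p m) : IsCartierFixed p (l + m) := by
  intro n
  simp only [map_add, hl n, hm n, add_pow_char]

lemma coeff_logDeriv_one_sub (c : K) {m : ℕ} (hm : 0 < m) (n : ℕ) :
    coeff n (logDeriv (1 - C c * X ^ m)) =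
      if m ∣ n ∧ 0 < n then - (m : K) * c ^ (n / m) else 0 := by
  have h0 : constantCoeff (1 - C c * X ^ m : PowerSeries K) = 1 := by
    simp [hm.ne']
  have key : logDeriv (1 - C c * X ^ m) * (1 - C c * X ^ m) = X * derivative K (1 - C c * X ^ m) := by
    rw [logDeriv, mul_assoc, PowerSeries.inv_mul_cancel _ (by simp [h0]), mul_one]
  set l := logDeriv (1 - C c * X ^ m : PowerSeries K)
  have hrec : ∀ n, coeff n l = (if n = m then - (m : K) * c else 0) +
      (if m ≤ n then c * coeff (n - m) l else 0) := by
    intro n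
    have := congrArg (coeff n) key
    rw [coeff_X_mul_derivative, mul_sub, mul_one, map_sub, ← mul_assoc, mul_comm l,
      coeff_mul_X_pow', map_sub, coeff_C_mul, coeff_C_mul, coeff_X_pow, coeff_one] at this
    rw [sub_eq_iff_eq_add] at this
    rw [this]
    congr 1
    rcases eq_or_ne n m with rfl | h
    · simp [hm.ne']
    · rcases eq_or_ne n 0 with rfl | h'
      · simp [h]
      · simp [h, h']
  induction n using Nat.strong_induction_on with
  | _ n ih =>
    rw [hrec n]
    rcases lt_or_ge n m with h | h
    · have h1 : ¬ (m ∣ n ∧ 0 < n) := fun h' => absurd (Nat.le_of_dvd h'.2 h'.1) (by omega)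
      simp [h.ne, h.not_ge, h1]
    · rw [if_pos h, ih (n - m) (by omega)]
      rcases eq_or_ne n m with rfl | hne
      · simp [hm, Nat.div_self hm]
      · have hpos : 0 < n - m := by omega
        have hd : m ∣ n - m ↔ m ∣ n := by
          rw [Nat.dvd_sub_iff_left h (dvd_refl m)]
        have hq : n / m = (n - m) / m + 1 := by
          rw [Nat.div_eq_sub_div hm h]
        by_cases hmn : m ∣ n
        · simp [hne, hd, hmn, hpos, (by omega : 0 < n), hq, pow_succ]; ring
        · simp [hne, hd, hmn]

/-- The coefficients are `-m c ^ (n / m)` on multiples of `m`. If `p ∣ m` they all vanish; otherwise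
`m ∣ p n` iff `m ∣ n`, and `m ^ p = m` in the prime field. -/
lemma isCartierFixed_logDeriv_one_sub {p : ℕ} [hp : Fact p.Prime] [CharP K p] (c : K) {m : ℕ}
    (hm : 0 < m) : IsCartierFixed p (logDeriv (1 - C c * X ^ m)) := by
  intro n
  have hp0 := hp.out.pos
  rw [coeff_logDeriv_one_sub c hm, coeff_logDeriv_one_sub c hm]
  by_cases hpm : p ∣ m
  · have : (m : K) = 0 := (CharP.cast_eq_zero_iff K p m).2 hpm
    simp [this, hp0.ne']
  · have hco : Nat.Coprime m p := ((hp.out.coprime_iff_not_dvd).2 hpm).symm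
    have h1 : (m ∣ p * n ∧ 0 < p * n) ↔ (m ∣ n ∧ 0 < n) := by
      rw [hco.dvd_mul_left, Nat.mul_pos_iff_of_pos_left hp0]
    simp only [h1]
    split_ifs with h
    · rw [mul_pow, ← pow_mul, Nat.mul_div_assoc _ h.1, mul_comm (n / m)]
      congr 1
      have := neg_one_pow_char K p
      have h2 : (m : K) ^ p = m := by
        rw [← frobenius_def p (m : K), map_natCast]
      rw [neg_pow, this, h2]; ring
    · simp [hp0.ne']

/-- Factors `1 - c X ^ m` are peeled off one degree at a time. Logarithmic derivatives turn their
product into a sum, and the Cartier relation is additive in characteristic `p`. -/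
lemma exists_isCartierFixed_approx {p : ℕ} [Fact p.Prime] [CharP K p] (a : PowerSeries K)
    (ha : constantCoeff a = 1) (N : ℕ) :
    ∃ b d : PowerSeries K, constantCoeff b = 1 ∧ IsCartierFixed p (logDeriv b) ∧
      a = b * (1 + X ^ (N + 1) * d) := by
  induction N with
  | zero =>
    obtain ⟨d, hd⟩ := X_dvd_iff.2 (show constantCoeff (a - 1) = 0 by simp [ha])
    refine ⟨1, d, by simp, ?_, by simp [← hd]⟩
    intro n
    simp [logDeriv, (Fact.out : p.Prime).ne_zero]
  | succ N ih =>
    obtain ⟨b, d, hb, hc, rfl⟩ := ih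
    set c := - constantCoeff d
    obtain ⟨e, he⟩ := X_dvd_iff.2 (show constantCoeff (d + C c) = 0 by simp [c])
    have h0 : constantCoeff (1 - C c * X ^ (N + 1) : PowerSeries K) = 1 := by simp
    have hinv : (1 - C c * X ^ (N + 1) : PowerSeries K) * (1 - C c * X ^ (N + 1))⁻¹ = 1 :=
      PowerSeries.mul_inv_cancel _ (by simp [h0])
    refine ⟨b * (1 - C c * X ^ (N + 1)), e * (1 - C c * X ^ (N + 1))⁻¹, by simp [hb], ?_, ?_⟩
    · rw [logDeriv_mul hb h0]
      exact hc.add (isCartierFixed_logDeriv_one_sub c (by omega))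
    · linear_combination (b * X ^ (N + 1)) * he - b * X ^ (N + 1 + 1) * e * hinv

theorem isCartierFixed_logDeriv {p : ℕ} [Fact p.Prime] [CharP K p] {a : PowerSeries K}
    (ha : constantCoeff a = 1) : IsCartierFixed p (logDeriv a) := by
  intro n
  -- The order `p * n + n` exceeds or equals both degrees `n` and `p * n` being compared.
  obtain ⟨b, d, hb, hc, rfl⟩ := exists_isCartierFixed_approx (p := p) a ha (p * n + n)
  have h0 : constantCoeff (1 + X ^ (p * n + n + 1) * d) = 1 := by simp
  have hz : ∀ k, k ≤ p * n + n → coeff k (logDeriv (1 + X ^ (p * n + n + 1) * d)) = 0 := by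
    intro k hk
    have : logDeriv (1 + X ^ (p * n + n + 1) * d) = X ^ (p * n + n + 1) *
        ((((p * n + n + 1 : ℕ) : PowerSeries K) * d + X * derivative K d) *
          (1 + X ^ (p * n + n + 1) * d)⁻¹) := by
      simp only [logDeriv, map_add, Derivation.leibniz, smul_eq_mul, derivative_one, zero_add,
        derivative_pow, derivative_X, Nat.add_sub_cancel]
      ring
    rw [this, coeff_X_pow_mul', if_neg (by omega)]
  rw [logDeriv_mul hb h0, map_add, map_add, hz _ (by omega), hz _ (by omega), add_zero, add_zero,
    hc n]

end LogDeriv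

end PowerSeries

/-! ### Coefficient bounds over ultrametric fields -/

namespace PowerSeries

section Bounds

variable {K : Type*} [NormedField K]

/-- The coefficients of `a` satisfy `‖aₖ‖ ≤ c * V ^ k`. -/
def CoeffBound (c V : ℝ) (a : PowerSeries K) : Prop :=
  ∀ k, ‖coeff k a‖ ≤ c * V ^ k

variable {c d V : ℝ} {a b : PowerSeries K}

lemma CoeffBound.mono (h : CoeffBound c V a) (hcd : c ≤ d) (hV : 0 ≤ V) : CoeffBound d V a :=
  fun k => (h k).trans (mul_le_mul_of_nonneg_right hcd (pow_nonneg hV k))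

lemma CoeffBound.nonneg (h : CoeffBound c V a) : 0 ≤ c := by
  simpa using (norm_nonneg _).trans (h 0)

lemma CoeffBound.neg (h : CoeffBound c V a) : CoeffBound c V (-a) := by
  intro k; simpa using h k

lemma CoeffBound.C_mul (h : CoeffBound c V a) (x : K) : CoeffBound (‖x‖ * c) V (C x * a) := by
  intro k
  rw [coeff_C_mul, norm_mul, mul_assoc]
  exact mul_le_mul_of_nonneg_left (h k) (norm_nonneg x)

lemma coeffBound_C (hV : 0 ≤ V) (x : K) : CoeffBound ‖x‖ V (C x) := by
  intro k
  rw [coeff_C]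
  split_ifs with h
  · simp [h]
  · simp; positivity

lemma coeffBound_one (hV : 0 ≤ V) : CoeffBound 1 V (1 : PowerSeries K) := by
  simpa using coeffBound_C hV (1 : K)

lemma coeffBound_C_mul_X_pow {x : K} {m : ℕ} (hx : ‖x‖ ≤ c * V ^ m) (hc : 0 ≤ c) (hV : 0 ≤ V) :
    CoeffBound c V (C x * X ^ m) := by
  intro k
  rw [coeff_C_mul, coeff_X_pow]
  split_ifs with h
  · simpa [h] using hx
  · simp; positivity

variable [IsUltrametricDist K]

lemma norm_add_le_of_le {x y : K} {B : ℝ} (hx : ‖x‖ ≤ B) (hy : ‖y‖ ≤ B) : ‖x + y‖ ≤ B :=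
  (IsUltrametricDist.norm_add_le_max x y).trans (max_le hx hy)

lemma norm_sub_le_of_le {x y : K} {B : ℝ} (hx : ‖x‖ ≤ B) (hy : ‖y‖ ≤ B) : ‖x - y‖ ≤ B := by
  rw [sub_eq_add_neg]; exact norm_add_le_of_le hx (by simpa using hy)

lemma norm_eq_of_norm_sub_lt {x y : K} (h : ‖x - y‖ < ‖y‖) : ‖x‖ = ‖y‖ := by
  have := IsUltrametricDist.norm_add_eq_max_of_norm_ne_norm (x := x - y) (y := y) h.ne
  rw [sub_add_cancel] at this
  rw [this, max_eq_right h.le]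

lemma CoeffBound.add (ha : CoeffBound c V a) (hb : CoeffBound c V b) : CoeffBound c V (a + b) :=
  fun k => by rw [map_add]; exact norm_add_le_of_le (ha k) (hb k)

lemma CoeffBound.sub (ha : CoeffBound c V a) (hb : CoeffBound c V b) : CoeffBound c V (a - b) :=
  fun k => by rw [map_sub]; exact norm_sub_le_of_le (ha k) (hb k)

lemma CoeffBound.mul (ha : CoeffBound c V a) (hb : CoeffBound d V b) (hV : 0 ≤ V) :
    CoeffBound (c * d) V (a * b) := by
  intro k
  have hc := ha.nonneg
  have hd := hb.nonneg
  rw [coeff_mul]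
  refine IsUltrametricDist.norm_sum_le_of_forall_le_of_nonneg (by positivity) fun x hx => ?_
  rw [norm_mul, ← Finset.HasAntidiagonal.mem_antidiagonal.1 hx, pow_add,
    show c * d * (V ^ x.1 * V ^ x.2) = (c * V ^ x.1) * (d * V ^ x.2) by ring]
  exact mul_le_mul (ha _) (hb _) (norm_nonneg _) (by positivity)

/-- Bound for a solution `x` of `D * x = y` with `D` a unit series. -/
lemma CoeffBound.of_mul {D x : PowerSeries K} (hV : 0 ≤ V) (hD : CoeffBound 1 V D)
    (hD0 : ‖coeff 0 D‖ = 1) (h : CoeffBound c V (D * x)) : CoeffBound c V x := by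
  have hc := h.nonneg
  intro k
  induction k using Nat.strong_induction_on with
  | _ k ih =>
    have h1 : coeff 0 D * coeff k x = coeff k (D * x) -
        ∑ i ∈ Finset.range k, coeff (i + 1) D * coeff (k - (i + 1)) x := by
      rw [coeff_mul, Finset.Nat.sum_antidiagonal_eq_sum_range_succ_mk, Finset.sum_range_succ']
      simp
    have h2 : ‖coeff k x‖ = ‖coeff 0 D * coeff k x‖ := by rw [norm_mul, hD0, one_mul]
    rw [h2, h1]
    refine norm_sub_le_of_le (h k)
      (IsUltrametricDist.norm_sum_le_of_forall_le_of_nonneg (by positivity) fun i hi => ?_)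
    have hik := Finset.mem_range.1 hi
    rw [norm_mul, show c * V ^ k = (1 * V ^ (i + 1)) * (c * V ^ (k - (i + 1))) by
      rw [show V ^ k = V ^ (i + 1) * V ^ (k - (i + 1)) by rw [← pow_add]; congr 1; omega]; ring]
    exact mul_le_mul (hD _) (ih _ (by omega)) (norm_nonneg _) (by positivity)

lemma CoeffBound.one_add (hc : c ≤ 1) (hV : 0 ≤ V) (h : CoeffBound c V a) :
    CoeffBound 1 V (1 + a) :=
  (coeffBound_one hV).add (h.mono hc hV)

lemma CoeffBound.one_add_pow_sub_one (hc : c ≤ 1) (hV : 0 ≤ V) (h : CoeffBound c V a) (j : ℕ) :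
    CoeffBound c V ((1 + a) ^ j - 1) := by
  induction j with
  | zero => intro k; simp; exact mul_nonneg h.nonneg (pow_nonneg hV k)
  | succ j ih =>
    rw [show (1 + a) ^ (j + 1) - 1 = ((1 + a) ^ j - 1) * (1 + a) + a by ring]
    exact CoeffBound.add (by simpa using ih.mul (h.one_add hc hV) hV) h

/-- If `2 * r + r ^ 2` is small then so is `r`. -/
lemma CoeffBound.of_two_mul_add_sq {r : PowerSeries K} (hV : 0 ≤ V) (hr0 : coeff 0 r = 0)
    (h2 : ‖(2 : K)‖ = 1) (hc : c ≤ 1) (h : CoeffBound c V (2 * r + r ^ 2)) : CoeffBound c V r := by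
  have hc0 := h.nonneg
  intro k
  induction k using Nat.strong_induction_on with
  | _ k ih =>
    rcases Nat.eq_zero_or_pos k with rfl | hk
    · rw [hr0]; simpa using hc0
    have h1 : 2 * coeff k r = coeff k (2 * r + r ^ 2) -
        ∑ i ∈ Finset.range k, coeff (i + 1) r * coeff (k - (i + 1)) r := by
      rw [map_add, pow_two, coeff_mul k r r, Finset.Nat.sum_antidiagonal_eq_sum_range_succ_mk,
        Finset.sum_range_succ', show (2 : PowerSeries K) = C 2 from rfl, coeff_C_mul]
      simp [hr0]
    have h3 : ‖coeff k r‖ = ‖2 * coeff k r‖ := by rw [norm_mul, h2, one_mul]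
    rw [h3, h1]
    refine norm_sub_le_of_le (h k)
      (IsUltrametricDist.norm_sum_le_of_forall_le_of_nonneg (by positivity) fun i hi => ?_)
    have hik := Finset.mem_range.1 hi
    rcases eq_or_ne (i + 1) k with hi' | hi'
    · simp [hi', hr0]; positivity
    have hp : V ^ k = V ^ (i + 1) * V ^ (k - (i + 1)) := by rw [← pow_add]; congr 1; omega
    rw [norm_mul]
    calc _ ≤ (c * V ^ (i + 1)) * (c * V ^ (k - (i + 1))) :=
          mul_le_mul (ih _ (by omega)) (ih _ (by omega)) (norm_nonneg _) (by positivity)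
      _ = c * (c * V ^ k) := by rw [hp]; ring
      _ ≤ 1 * (c * V ^ k) := mul_le_mul_of_nonneg_right hc (by positivity)
      _ = _ := one_mul _

end Bounds

/-! ### Norms of integers and of the divisors `L ^ k - 1` -/

section NatCast

variable {K : Type*} [NormedField K] {p : ℕ} [hp : Fact p.Prime] [CharP K p]

/-- A nonzero element of the prime field is a root of unity: `k ^ (p - 1) = 1`. -/
lemma norm_natCast_eq_one_of_not_dvd {k : ℕ} (h : ¬ p ∣ k) : ‖(k : K)‖ = 1 := by
  have hk : (k : K) ≠ 0 := fun h0 => h ((CharP.cast_eq_zero_iff K p k).1 h0)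
  have h1 : (k : K) ^ p = k := by
    rw [← frobenius_def p (k : K), map_natCast]
  have h2 : (k : K) ^ (p - 1) = 1 := by
    have : (k : K) ^ (p - 1) * k = 1 * k := by
      rw [← pow_succ, Nat.sub_add_cancel hp.out.one_le, h1, one_mul]
    exact mul_right_cancel₀ hk this
  have h3 : ‖(k : K)‖ ^ (p - 1) = 1 := by rw [← norm_pow, h2, norm_one]
  exact (pow_eq_one_iff_of_nonneg (norm_nonneg _) (by have := hp.out.two_le; omega)).1 h3

variable [IsUltrametricDist K]

lemma norm_eq_one_of_norm_sub_one_lt {L : K} (h : ‖L - 1‖ < 1) : ‖L‖ = 1 := by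
  have := norm_eq_of_norm_sub_lt (x := L) (y := 1) (by simpa using h)
  simpa using this

lemma norm_pow_sub_one_sub_le {L : K} (h : ‖L - 1‖ < 1) (k : ℕ) :
    ‖L ^ k - 1 - k * (L - 1)‖ ≤ ‖L - 1‖ ^ 2 := by
  have hL := norm_eq_one_of_norm_sub_one_lt h
  have h1 : ∀ k : ℕ, ‖L ^ k - 1‖ ≤ ‖L - 1‖ := by
    intro k
    induction k with
    | zero => simp
    | succ k ih =>
      rw [show L ^ (k + 1) - 1 = (L ^ k - 1) * L + (L - 1) by ring]
      exact norm_add_le_of_le (by rw [norm_mul, hL, mul_one]; exact ih) le_rfl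
  induction k with
  | zero => simp
  | succ k ih =>
    rw [show L ^ (k + 1) - 1 - (k + 1 : ℕ) * (L - 1) =
      (L ^ k - 1 - k * (L - 1)) + (L ^ k - 1) * (L - 1) by push_cast; ring]
    refine norm_add_le_of_le ih ?_
    rw [norm_mul, pow_two]
    exact mul_le_mul_of_nonneg_right (h1 k) (norm_nonneg _)

/-- The linear term `k (L - 1)` dominates, since `k` has norm 1 and the remainder is quadratic.
Small divisors thus occur only for `p ∣ k`. -/
lemma norm_pow_sub_one_of_not_dvd {L : K} (h : ‖L - 1‖ < 1) {k : ℕ} (hk : ¬ p ∣ k) :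
    ‖L ^ k - 1‖ = ‖L - 1‖ := by
  rcases eq_or_ne L 1 with rfl | hL
  · simp
  have hpos : 0 < ‖L - 1‖ := norm_pos_iff.2 (sub_ne_zero.2 hL)
  have h1 : ‖(k : K) * (L - 1)‖ = ‖L - 1‖ := by
    rw [norm_mul, norm_natCast_eq_one_of_not_dvd hk, one_mul]
  rw [← h1]
  refine norm_eq_of_norm_sub_lt ?_
  rw [h1]
  refine (norm_pow_sub_one_sub_le h k).trans_lt ?_
  nlinarith

end NatCast

end PowerSeries

/-! ### Substitution of near-identity series -/

namespace PowerSeries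

section Twist

variable {K : Type*} [Field K]

/-- The series `L * X * (1 + r)`. -/
noncomputable def twist (L : K) (r : PowerSeries K) : PowerSeries K := C L * X * (1 + r)

lemma hasSubst_twist (L : K) (r : PowerSeries K) : HasSubst (twist L r) :=
  HasSubst.of_constantCoeff_zero' (by simp [twist])

lemma coeff_subst_twist (L : K) (r a : PowerSeries K) (k : ℕ) :
    coeff k (a.subst (twist L r)) =
      ∑ j ∈ Finset.range (k + 1), coeff j a * L ^ j * coeff (k - j) ((1 + r) ^ j) := by
  have h : ∀ j, coeff k (twist L r ^ j) =
      if j ≤ k then L ^ j * coeff (k - j) ((1 + r) ^ j) else 0 := by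
    intro j
    rw [twist, mul_pow, mul_pow, ← map_pow, mul_assoc, coeff_C_mul, coeff_X_pow_mul']
    split_ifs <;> simp
  rw [coeff_subst' (hasSubst_twist L r), finsum_eq_sum_of_support_subset (s := Finset.range (k + 1))]
  · refine Finset.sum_congr rfl fun j hj => ?_
    rw [h, if_pos (by have := Finset.mem_range.1 hj; omega), smul_eq_mul, mul_assoc]
  · intro j hj
    by_contra hcon
    refine hj ?_
    simp only [Finset.coe_range, Set.mem_Iio, not_lt] at hcon
    simp only [h, if_neg (by omega : ¬ j ≤ k), smul_zero]

lemma coeff_zero_subst_twist (L : K) (r a : PowerSeries K) :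
    coeff 0 (a.subst (twist L r)) = coeff 0 a := by
  rw [coeff_subst_twist]; simp

lemma coeff_zero_mul (a b : PowerSeries K) : coeff 0 (a * b) = coeff 0 a * coeff 0 b := by
  simp only [coeff_zero_eq_constantCoeff_apply, map_mul]

variable {p : ℕ} [hp : Fact p.Prime] [CharP K p]

lemma pow_char_eq_expand_map (r : PowerSeries K) :
    r ^ p = expand p hp.out.ne_zero (map (frobenius K p) r) := by
  rw [← map_expand]
  exact (MvPowerSeries.map_frobenius_expand p hp.out.ne_zero).symm

/-- Since `(L X (1 + r)) ^ p = L ^ p X ^ p (1 + r ^ p)` and `r ^ p` is the Frobenius twist of `r`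
evaluated at `X ^ p`, series in `X ^ p` are stable under the substitution. -/
lemma expand_subst_twist (L : K) (r U : PowerSeries K) :
    (expand p hp.out.ne_zero U).subst (twist L r) =
      expand p hp.out.ne_zero (U.subst (twist (L ^ p) (map (frobenius K p) r))) := by
  have hX : HasSubst (X ^ p : PowerSeries K) := HasSubst.X_pow hp.out.ne_zero
  have hC : CharP (PowerSeries K) p :=
    charP_of_injective_ringHom (f := (C : K →+* PowerSeries K)) C_injective p
  rw [expand_apply, expand_apply, subst_comp_subst_apply hX (hasSubst_twist L r),
    subst_comp_subst_apply (hasSubst_twist _ _) hX]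
  congr 1
  rw [subst_pow (hasSubst_twist L r), subst_X (hasSubst_twist L r), ← expand_apply _ hp.out.ne_zero]
  rw [twist, twist, map_mul, map_mul, map_add, map_one, expand_C, expand_X, ← pow_char_eq_expand_map,
    mul_pow, mul_pow, add_pow_char, one_pow, map_pow]

end Twist

section FirstOrder

variable {K : Type*} [NormedField K] [IsUltrametricDist K] {L : K} {r a : PowerSeries K}
  {c d V : ℝ}

/-- The substitution of `L * X * (1 + r)` into `a` differs little from rescaling by `L`. -/
lemma norm_coeff_subst_twist_sub_le (hV : 0 ≤ V) (hL : ‖L‖ = 1) (hd : d ≤ 1) (hc : 0 ≤ c)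
    (hr : CoeffBound d V r) (k : ℕ) (ha : ∀ j, 0 < j → j < k → ‖coeff j a‖ ≤ c * V ^ j)
    (hr0 : coeff 0 r = 0) :
    ‖coeff k (a.subst (twist L r)) - L ^ k * coeff k a‖ ≤ c * d * V ^ k := by
  have hd0 := hr.nonneg
  have h1 : coeff k (a.subst (twist L r)) - L ^ k * coeff k a =
      ∑ j ∈ Finset.range k, coeff j a * L ^ j * coeff (k - j) ((1 + r) ^ j - 1) := by
    rw [coeff_subst_twist, Finset.sum_range_succ]
    have : coeff (k - k) ((1 + r) ^ k) = 1 := by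
      rw [Nat.sub_self, coeff_zero_eq_constantCoeff_apply, map_pow, map_add, map_one,
        ← coeff_zero_eq_constantCoeff_apply, hr0, add_zero, one_pow]
    rw [this, mul_one, mul_comm (coeff k a), add_sub_cancel_right]
    refine Finset.sum_congr rfl fun j hj => ?_
    have hj' := Finset.mem_range.1 hj
    rw [map_sub, coeff_one, if_neg (by omega), sub_zero]
  rw [h1]
  refine IsUltrametricDist.norm_sum_le_of_forall_le_of_nonneg (by positivity) fun j hj => ?_
  have hj' := Finset.mem_range.1 hj
  rcases Nat.eq_zero_or_pos j with rfl | hj0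
  · simp; positivity
  rw [norm_mul, norm_mul, norm_pow, hL, one_pow, mul_one]
  calc _ ≤ (c * V ^ j) * (d * V ^ (k - j)) :=
        mul_le_mul (ha j hj0 hj') (hr.one_add_pow_sub_one hd hV j _) (norm_nonneg _)
          (by positivity)
    _ = c * d * (V ^ j * V ^ (k - j)) := by ring
    _ = _ := by rw [← pow_add, Nat.add_sub_cancel' hj'.le]

variable {p : ℕ} [hp : Fact p.Prime] [CharP K p] {g v G : PowerSeries K} {mu : ℝ}

/-- Coefficient bounds for a solution of `v(L X (1 + r)) (1 + g) = v (1 + G(X ^ p))`. -/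
lemma resonant_bounds (hV : 0 ≤ V) (hL1 : L ≠ 1) (hL : ‖L - 1‖ < 1) (hmu : mu ≤ 1)
    (hr : CoeffBound (‖L - 1‖ * mu) V r) (hr0 : coeff 0 r = 0)
    (hg : CoeffBound (‖L - 1‖ * mu) V g) (hg0 : coeff 0 g = 0) (hG0 : coeff 0 G = 0)
    (hv0 : coeff 0 v = 1) (hv : ∀ k, 0 < k → p ∣ k → coeff k v = 0)
    (heq : v.subst (twist L r) * (1 + g) = v * (1 + expand p hp.out.ne_zero G)) :
    CoeffBound mu V (v - 1) ∧ CoeffBound (‖L - 1‖ * mu) V (expand p hp.out.ne_zero G) := by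
  set e := ‖L - 1‖
  have hepos : 0 < e := norm_pos_iff.2 (sub_ne_zero.2 hL1)
  have hmu0 : 0 ≤ mu := (mul_nonneg_iff_of_pos_left hepos).1 hg.nonneg
  have hLn := norm_eq_one_of_norm_sub_one_lt hL
  set S := v.subst (twist L r)
  set H := expand p hp.out.ne_zero G with hHdef
  have hH0 : coeff 0 H = 0 := by
    have := coeff_expand_mul p hp.out.ne_zero G 0
    rwa [mul_zero, hG0] at this
  have hemu : e * mu ≤ 1 := by nlinarith
  have hS0 : coeff 0 S = 1 := by
    simp [S, coeff_subst_twist, hv0]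
  have main : ∀ k, 0 < k → ‖coeff k v‖ ≤ mu * V ^ k ∧ ‖coeff k H‖ ≤ e * mu * V ^ k := by
    intro k
    induction k using Nat.strong_induction_on with
    | _ k ih =>
      intro hk
      have hvj : ∀ j, 0 < j → j < k → ‖coeff j v‖ ≤ mu * V ^ j := fun j h0 h1 => (ih j h1 h0).1
      have hvj' : ∀ j, j < k → ‖coeff j v‖ ≤ 1 * V ^ j := by
        intro j hj
        rcases Nat.eq_zero_or_pos j with rfl | h0
        · simp [hv0]
        · exact (hvj j h0 hj).trans (mul_le_mul_of_nonneg_right hmu (by positivity))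
      have hR : ∀ j, j ≤ k → ‖coeff j S - L ^ j * coeff j v‖ ≤ e * mu * V ^ j := by
        intro j hj
        have := norm_coeff_subst_twist_sub_le (a := v) hV hLn hemu zero_le_one hr j
          (fun i _ hi => hvj' i (by omega)) hr0
        rwa [one_mul] at this
      have hSj : ∀ j, j < k → ‖coeff j S‖ ≤ 1 * V ^ j := by
        intro j hj
        rw [← sub_add_cancel (coeff j S) (L ^ j * coeff j v)]
        refine norm_add_le_of_le ((hR j hj.le).trans ?_) ?_
        · exact mul_le_mul_of_nonneg_right hemu (by positivity)
        · rw [norm_mul, norm_pow, hLn, one_pow, one_mul]; exact hvj' j hj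
      have e1 : coeff k (S * (1 + g)) = coeff k S +
          ∑ i ∈ Finset.range k, coeff (i + 1) g * coeff (k - (i + 1)) S := by
        rw [mul_add, mul_one, map_add, mul_comm S g, coeff_mul,
          Finset.Nat.sum_antidiagonal_eq_sum_range_succ_mk, Finset.sum_range_succ']
        simp [hg0]
      have e2 : coeff k (v * (1 + H)) = coeff k v + coeff k H +
          ∑ i ∈ Finset.range (k - 1), coeff (i + 1) H * coeff (k - (i + 1)) v := by
        obtain ⟨n, rfl⟩ : ∃ n, k = n + 1 := ⟨k - 1, by omega⟩
        rw [mul_add, mul_one, map_add, mul_comm v H, coeff_mul,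
          Finset.Nat.sum_antidiagonal_eq_sum_range_succ_mk, Finset.sum_range_succ',
          Finset.sum_range_succ]
        simp [hH0, hv0]; ring
      -- In degree `k` only one of the two unknowns is present: `coeff k v` if `p ∤ k`, `coeff k H`
      -- if `p ∣ k`. Everything else is controlled by lower degrees.
      have hX : ‖(L ^ k - 1) * coeff k v - coeff k H‖ ≤ e * mu * V ^ k := by
        have : (L ^ k - 1) * coeff k v - coeff k H =
            (∑ i ∈ Finset.range (k - 1), coeff (i + 1) H * coeff (k - (i + 1)) v) -
            (∑ i ∈ Finset.range k, coeff (i + 1) g * coeff (k - (i + 1)) S) -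
            (coeff k S - L ^ k * coeff k v) := by
          have h3 := congrArg (coeff k) heq
          rw [e1, e2] at h3
          linear_combination h3
        rw [this]
        have hpw : ∀ i, i < k → V ^ k = V ^ (i + 1) * V ^ (k - (i + 1)) := by
          intro i hi; rw [← pow_add]; congr 1; omega
        refine norm_sub_le_of_le (norm_sub_le_of_le ?_ ?_) (hR k le_rfl)
        · refine IsUltrametricDist.norm_sum_le_of_forall_le_of_nonneg (by positivity) fun i hi => ?_
          have hi' := Finset.mem_range.1 hi
          rw [norm_mul, hpw i (by omega), ← mul_assoc, ← one_mul (V ^ (k - (i + 1)))]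
          exact mul_le_mul (ih (i + 1) (by omega) (by omega)).2 (hvj' _ (by omega))
            (norm_nonneg _) (by positivity)
        · refine IsUltrametricDist.norm_sum_le_of_forall_le_of_nonneg (by positivity) fun i hi => ?_
          have hi' := Finset.mem_range.1 hi
          rw [norm_mul, hpw i hi', ← mul_assoc, ← one_mul (V ^ (k - (i + 1)))]
          exact mul_le_mul (hg _) (hSj _ (by omega)) (norm_nonneg _) (by positivity)
      by_cases hpk : p ∣ k
      · rw [hv k hk hpk] at hX ⊢
        simp only [mul_zero, zero_sub, norm_neg] at hX
        exact ⟨by simp; positivity, hX⟩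
      · have hHk : coeff k H = 0 := coeff_expand_of_not_dvd p _ _ hpk
        rw [hHk] at hX ⊢
        rw [sub_zero, norm_mul, norm_pow_sub_one_of_not_dvd (p := p) hL hpk, mul_assoc] at hX
        exact ⟨le_of_mul_le_mul_left hX hepos, by simp; positivity⟩
  constructor
  · intro k
    rcases Nat.eq_zero_or_pos k with rfl | hk
    · rw [map_sub, hv0]; simpa using hmu0
    · rw [map_sub, coeff_one, if_neg hk.ne', sub_zero]; exact (main k hk).1
  · intro k
    rcases Nat.eq_zero_or_pos k with rfl | hk
    · rw [hH0]; simp; positivity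
    · exact (main k hk).2

end FirstOrder

end PowerSeries

/-! ### Renormalization of the cohomological equation -/

namespace PowerSeries

section Renormalize

variable {K : Type*} [Field K] {p : ℕ} [hp : Fact p.Prime]

/-- `U(X ^ p)` is the part of `u` in degrees divisible by `p`, and `v` is the quotient. In degree `p
m` of `v * U(X ^ p)`, induction removes all terms except the two extreme ones, whence `coeff (p m) v
= 0`. -/
lemma exists_eq_mul_expand (u : PowerSeries K) (hu : coeff 0 u = 1) :
    ∃ v U : PowerSeries K, u = v * expand p hp.out.ne_zero U ∧ coeff 0 v = 1 ∧
      (∀ k, 0 < k → p ∣ k → coeff k v = 0) ∧ ∀ k, coeff k U = coeff (p * k) u := by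
  set U : PowerSeries K := mk fun k => coeff (p * k) u with hU
  have hUc : ∀ k, coeff k U = coeff (p * k) u := fun k => by simp [hU]
  set H := expand p hp.out.ne_zero U with hH
  have hH0 : coeff 0 H = 1 := by
    have := coeff_expand_mul p hp.out.ne_zero U 0
    rwa [mul_zero, hUc, mul_zero, hu] at this
  have hinv : H⁻¹ * H = 1 := PowerSeries.inv_mul_cancel H (by
    rw [← coeff_zero_eq_constantCoeff_apply, hH0]; exact one_ne_zero)
  have hv : u = u * H⁻¹ * H := by rw [mul_assoc, hinv, mul_one]
  set v := u * H⁻¹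
  have hv0 : coeff 0 v = 1 := by
    have := congrArg (coeff 0) hv
    rw [coeff_zero_mul, hu, hH0, mul_one] at this
    exact this.symm
  refine ⟨v, U, hv, hv0, ?_, hUc⟩
  intro k
  induction k using Nat.strong_induction_on with
  | _ k ih =>
    intro hk hpk
    obtain ⟨m, rfl⟩ := hpk
    have h1 := congrArg (coeff (p * m)) hv
    rw [coeff_mul, Finset.sum_eq_add (0, p * m) (p * m, 0)] at h1
    · have h2 : coeff (p * m) H = coeff (p * m) u := by rw [hH, coeff_expand_mul, hUc]
      simp only [hv0, hH0, h2, one_mul, mul_one] at h1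
      exact left_eq_add.1 h1
    · intro h; exact hk.ne' (congrArg Prod.snd h)
    · rintro ⟨i, j⟩ hij ⟨hne1, hne2⟩
      have hs : i + j = p * m := by simpa using hij
      have hi0 : i ≠ 0 := fun h => hne1 (by simp [h] at hs ⊢; exact hs)
      have hj0 : j ≠ 0 := fun h => hne2 (by simp [h] at hs ⊢; exact hs)
      by_cases hpj : p ∣ j
      · have hpi : p ∣ i := (Nat.dvd_add_left hpj).1 (hs ▸ dvd_mul_right p m)
        simp [ih i (by omega) (by omega) hpi]
      · simp [hH, coeff_expand_of_not_dvd p hp.out.ne_zero U hpj]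
    · intro h; exact absurd (by simp) h
    · intro h; exact absurd (by simp) h

variable [CharP K p]

/-- A solution of `u(L X (1 + r)) (1 + g) = u` factors as `v * U(X ^ p)` with `U` solving an
equation of the same type. -/
lemma exists_renormalization {L : K} {r g u : PowerSeries K} (hu : coeff 0 u = 1)
    (heq : u.subst (twist L r) * (1 + g) = u) :
    ∃ v U G : PowerSeries K, coeff 0 v = 1 ∧ (∀ k, 0 < k → p ∣ k → coeff k v = 0) ∧
      (∀ k, coeff k U = coeff (p * k) u) ∧ coeff 0 G = 0 ∧
      v.subst (twist L r) * (1 + g) = v * (1 + expand p hp.out.ne_zero G) ∧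
      U.subst (twist (L ^ p) (map (frobenius K p) r)) * (1 + G) = U := by
  obtain ⟨v, U, huv, hv0, hv, hU⟩ := exists_eq_mul_expand (p := p) u hu
  set U' := U.subst (twist (L ^ p) (map (frobenius K p) r)) with hU'
  have hU0 : coeff 0 U = 1 := by rw [hU, mul_zero, hu]
  have hU'0 : coeff 0 U' = 1 := by rw [hU', coeff_zero_subst_twist, hU0]
  have hinv : U' * U'⁻¹ = 1 := PowerSeries.mul_inv_cancel U' (by
    rw [← coeff_zero_eq_constantCoeff_apply, hU'0]; exact one_ne_zero)
  have hG : U' * (1 + (U * U'⁻¹ - 1)) = U := by linear_combination U * hinv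
  have hne : expand p hp.out.ne_zero U' ≠ 0 := by
    intro h
    have := coeff_expand_mul p hp.out.ne_zero U' 0
    rw [h, hU'0] at this
    simp at this
  refine ⟨v, U, U * U'⁻¹ - 1, hv0, hv, hU, ?_, ?_, hG⟩
  · have := congrArg (coeff 0) hG
    rw [coeff_zero_mul, hU'0, one_mul, map_add, hU0, coeff_zero_one] at this
    exact add_eq_left.1 this
  -- Substituting into `u = v * U(X ^ p)` gives an equation with common factor `U'(X ^ p)`, which is
  -- then cancelled.
  · have h1 : v.subst (twist L r) * expand p hp.out.ne_zero U' * (1 + g) =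
        v * expand p hp.out.ne_zero U := by
      rw [hU', ← expand_subst_twist, ← subst_mul (hasSubst_twist L r), ← huv]
      exact heq
    have h2 := congrArg (expand p hp.out.ne_zero) hG
    rw [map_mul] at h2
    have h3 : expand p hp.out.ne_zero (1 + (U * U'⁻¹ - 1)) =
        1 + expand p hp.out.ne_zero (U * U'⁻¹ - 1) := by rw [map_add, map_one]
    rw [h3] at h2
    refine mul_left_cancel₀ hne ?_
    linear_combination h1 - v * h2

end Renormalize

section FirstOrder

variable {K : Type*} [NormedField K] [IsUltrametricDist K] {L : K} {r g v G H : PowerSeries K}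
  {V mu th : ℝ}

lemma coeffBound_subst_twist_sub_one (hV : 0 ≤ V) (hL : ‖L - 1‖ < 1) (hmu : mu ≤ 1)
    (hr : CoeffBound (‖L - 1‖ * mu) V r) (hr0 : coeff 0 r = 0) (hv0 : coeff 0 v = 1)
    (hv : CoeffBound mu V (v - 1)) : CoeffBound mu V (v.subst (twist L r) - 1) := by
  have hmu0 := hv.nonneg
  have hLn := norm_eq_one_of_norm_sub_one_lt hL
  have he := norm_nonneg (L - 1)
  have hemu : ‖L - 1‖ * mu ≤ 1 := by nlinarith
  have hvk : ∀ k, 0 < k → ‖coeff k v‖ ≤ mu * V ^ k := by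
    intro k hk
    have := hv k
    rwa [map_sub, coeff_one, if_neg hk.ne', sub_zero] at this
  intro k
  rcases Nat.eq_zero_or_pos k with rfl | hk
  · rw [map_sub, coeff_zero_subst_twist, hv0, coeff_zero_one, sub_self, norm_zero]; simpa using hmu0
  · have h1 := norm_coeff_subst_twist_sub_le hV hLn hemu hmu0 hr k (fun j hj _ => hvk j hj) hr0
    rw [map_sub, coeff_one, if_neg hk.ne', sub_zero,
      ← sub_add_cancel (coeff k _) (L ^ k * coeff k v)]
    refine norm_add_le_of_le (h1.trans ?_) ?_
    · refine mul_le_mul_of_nonneg_right ?_ (by positivity)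
      nlinarith
    · rw [norm_mul, norm_pow, hLn, one_pow, one_mul]; exact hvk k hk

/-- The resonant part of the solution agrees with `g` up to quadratic terms. -/
lemma norm_coeff_sub_le_of_resonant (hV : 0 ≤ V) (hL : ‖L - 1‖ < 1) (hmu : mu ≤ 1)
    (hr : CoeffBound (‖L - 1‖ * mu) V r) (hr0 : coeff 0 r = 0)
    (hg : CoeffBound (‖L - 1‖ * mu) V g) (hv0 : coeff 0 v = 1)
    (hv : CoeffBound mu V (v - 1)) (hH : CoeffBound (‖L - 1‖ * mu) V H)
    (heq : v.subst (twist L r) * (1 + g) = v * (1 + H)) {k : ℕ} (hvk : coeff k v = 0) :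
    ‖coeff k H - coeff k g‖ ≤ ‖L - 1‖ * mu * mu * V ^ k := by
  have hS := coeffBound_subst_twist_sub_one hV hL hmu hr hr0 hv0 hv
  have hmu0 := hv.nonneg
  have hLn := norm_eq_one_of_norm_sub_one_lt hL
  have he := norm_nonneg (L - 1)
  have hemu : ‖L - 1‖ * mu ≤ 1 := by nlinarith
  have hvk' : ∀ j, 0 < j → j < k → ‖coeff j v‖ ≤ mu * V ^ j := by
    intro j hj _
    have := hv j
    rwa [map_sub, coeff_one, if_neg hj.ne', sub_zero] at this
  have h1 := norm_coeff_subst_twist_sub_le hV hLn hemu hmu0 hr k hvk' hr0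
  set S := v.subst (twist L r)
  have h2 : coeff k H - coeff k g = coeff k S + coeff k (g * (S - 1)) - coeff k (H * (v - 1)) := by
    have := congrArg (coeff k) (show H - g = S - v + g * (S - 1) - H * (v - 1) by
      linear_combination -heq)
    simpa [hvk] using this
  rw [hvk, mul_zero, sub_zero] at h1
  rw [h2]
  refine norm_sub_le_of_le (norm_add_le_of_le ?_ ((hg.mul hS hV) k)) ((hH.mul hv hV) k)
  rwa [show ‖L - 1‖ * mu * mu = mu * (‖L - 1‖ * mu) by ring]

/-- To first order, the resonant part of the solution is governed by a logarithmic derivative. -/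
lemma coeffBound_sub_logDeriv (hV : 0 ≤ V) (hL : ‖L - 1‖ ≤ th) (hth : th < 1)
    (hr : CoeffBound (‖L - 1‖ * th) V r) (hr0 : coeff 0 r = 0)
    (hg : CoeffBound ‖L - 1‖ V g) (hv0 : coeff 0 v = 1) (hv : CoeffBound 1 V (v - 1))
    (heq : v.subst (twist L r) * (1 + g) = v * (1 + H)) :
    CoeffBound (‖L - 1‖ * th) V (H - g - C (L - 1) * logDeriv v) := by
  have he := norm_nonneg (L - 1)
  have hL1 := hL.trans_lt hth
  have hth0 := he.trans hL
  have hLn := norm_eq_one_of_norm_sub_one_lt hL1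
  have heth : ‖L - 1‖ * th ≤ 1 := by nlinarith
  have hvb : CoeffBound 1 V v := by simpa using (coeffBound_one hV).add hv
  set S := v.subst (twist L r)
  -- Rescaling by `L` multiplies degree `k` by `L ^ k ≈ 1 + k (L - 1)`, so `S - v` is `(L - 1) X v'`
  -- to first order.
  have h1 : CoeffBound (‖L - 1‖ * th) V (S - v - C (L - 1) * (X * derivative K v)) := by
    intro k
    have h2 := norm_coeff_subst_twist_sub_le hV hLn heth zero_le_one hr k (fun j _ _ => hvb j) hr0
    rw [one_mul] at h2
    rw [map_sub, map_sub, coeff_C_mul, coeff_X_mul_derivative,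
      show coeff k S - coeff k v - (L - 1) * (k * coeff k v) =
        (coeff k S - L ^ k * coeff k v) + (L ^ k - 1 - k * (L - 1)) * coeff k v by ring]
    refine norm_add_le_of_le h2 ?_
    rw [norm_mul]
    calc _ ≤ ‖L - 1‖ ^ 2 * (1 * V ^ k) :=
          mul_le_mul (norm_pow_sub_one_sub_le hL1 k) (hvb k) (norm_nonneg _) (by positivity)
      _ ≤ _ := by
          rw [one_mul, pow_two]
          gcongr
  have h3 : CoeffBound ‖L - 1‖ V (C (L - 1) * (X * derivative K v)) := by
    have : CoeffBound 1 V (X * derivative K v) := by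
      intro k
      rw [coeff_X_mul_derivative, norm_mul]
      calc _ ≤ 1 * (1 * V ^ k) := mul_le_mul (IsUltrametricDist.norm_natCast_le_one K k) (hvb k)
            (norm_nonneg _) zero_le_one
        _ = _ := one_mul _
    simpa using this.C_mul (L - 1)
  have h4 : CoeffBound ‖L - 1‖ V (S - v) := by
    have := (h1.mono (show ‖L - 1‖ * th ≤ ‖L - 1‖ by nlinarith) hV).add h3
    simpa using this
  have hvne : constantCoeff v ≠ 0 := by
    rw [← coeff_zero_eq_constantCoeff_apply, hv0]; exact one_ne_zero
  have h5 : v * logDeriv v = X * derivative K v := by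
    have := PowerSeries.mul_inv_cancel v hvne
    rw [logDeriv]; linear_combination (X * derivative K v) * this
  -- Dividing by the unit series `v` preserves bounds, so the estimate may be proved after
  -- multiplication by `v`.
  refine CoeffBound.of_mul hV hvb (by rw [hv0, norm_one]) ?_
  rw [show v * (H - g - C (L - 1) * logDeriv v) =
    (S - v - C (L - 1) * (X * derivative K v)) + g * (S - v) by
    linear_combination -heq - C (L - 1) * h5]
  exact h1.add ((hg.mul h4 hV).mono (by gcongr) hV)

end FirstOrder

end PowerSeries

/-! ### Iterating the renormalization -/

namespace PowerSeries

section State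

variable {K : Type*} [NormedField K]

/-- Data of a cohomological equation `u(L X (1 + r)) (1 + g) = u` in which, at radius `1 / V`,
the series `g` has size `‖L - 1‖`, attained in degree `1` or `2`, while `r` and the terms of
`g` of degree at least `3` are smaller. -/
structure IsRenormState (th V D : ℝ) (L : K) (r g u : PowerSeries K) : Prop where
  ne_one : L ≠ 1
  norm_le : ‖L - 1‖ ≤ th
  pos : 0 < V
  coeff_zero_r : coeff 0 r = 0
  coeff_zero_g : coeff 0 g = 0
  coeff_zero_u : coeff 0 u = 1
  eqn : u.subst (twist L r) * (1 + g) = u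
  bound_r : CoeffBound (‖L - 1‖ * th) V r
  bound_g : CoeffBound ‖L - 1‖ V g
  bound_g_tail : ∀ k, 3 ≤ k → ‖coeff k g‖ ≤ ‖L - 1‖ * th * V ^ k
  norm_eq : ‖coeff 1 g‖ = ‖L - 1‖ * V ∨ ‖coeff 2 g‖ = ‖L - 1‖ * V ^ 2
  bound_u : ∀ k, ‖coeff k u‖ ≤ D ^ k

lemma norm_pow_char_sub_one {p : ℕ} [Fact p.Prime] [CharP K p] (L : K) :
    ‖L ^ p - 1‖ = ‖L - 1‖ ^ p := by
  rw [← norm_pow, sub_pow_char, one_pow]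

variable [IsUltrametricDist K] {th V D : ℝ} {L : K} {r g u : PowerSeries K}
  {p : ℕ} [hp : Fact p.Prime] [CharP K p]

/-- Solving the equation in degrees 1 and 2 gives `‖u₁‖ = V` or `‖u₂‖ = V ^ 2`. In the second case
`‖u₁‖ < V`, so the products involving `u₁` cannot cancel `coeff 2 g`. -/
lemma IsRenormState.le (hp2 : p ≠ 2) (hth : th < 1) (h : IsRenormState th V D L r g u) :
    V ≤ D := by
  have hepos : 0 < ‖L - 1‖ := norm_pos_iff.2 (sub_ne_zero.2 h.ne_one)
  have hL1 := h.norm_le.trans_lt hth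
  have hLn := norm_eq_one_of_norm_sub_one_lt hL1
  have hV := h.pos
  have hu1 := h.bound_u 1
  have hu2 := h.bound_u 2
  rw [pow_one] at hu1
  have hD : 0 ≤ D := (norm_nonneg _).trans hu1
  have e1 : (L - 1) * coeff 1 u = - coeff 1 g := by
    have := congrArg (coeff 1) h.eqn
    rw [mul_add, mul_one, map_add, coeff_mul, Finset.Nat.sum_antidiagonal_eq_sum_range_succ_mk] at this
    simp only [coeff_subst_twist, Finset.sum_range_succ, Finset.sum_range_zero, h.coeff_zero_u,
      h.coeff_zero_g, pow_zero, pow_one, coeff_one] at this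
    simp [-coeff_zero_eq_constantCoeff, h.coeff_zero_r] at this
    linear_combination this
  have n1 : ‖L - 1‖ * ‖coeff 1 u‖ = ‖coeff 1 g‖ := by rw [← norm_mul, e1, norm_neg]
  by_cases hg1 : ‖coeff 1 g‖ = ‖L - 1‖ * V
  · rw [hg1] at n1
    exact (mul_left_cancel₀ hepos.ne' n1) ▸ hu1
  · have hg2 := h.norm_eq.resolve_left hg1
    have hg1' : ‖coeff 1 g‖ < ‖L - 1‖ * V :=
      lt_of_le_of_ne (by simpa using h.bound_g 1) hg1
    have hu1' : ‖coeff 1 u‖ < V := by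
      rw [← n1] at hg1'; exact lt_of_mul_lt_mul_left hg1' hepos.le
    have e2 : (L ^ 2 - 1) * coeff 2 u = - (L * coeff 1 u * (coeff 1 r + coeff 1 g) + coeff 2 g) := by
      have := congrArg (coeff 2) h.eqn
      rw [mul_add, mul_one, map_add, coeff_mul,
        Finset.Nat.sum_antidiagonal_eq_sum_range_succ_mk] at this
      simp only [coeff_subst_twist, Finset.sum_range_succ, Finset.sum_range_zero, h.coeff_zero_u,
        h.coeff_zero_g, pow_zero, pow_one, coeff_one] at this
      simp [-coeff_zero_eq_constantCoeff, h.coeff_zero_r, coeff_zero_mul, pow_two,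
        coeff_one] at this
      linear_combination this
    have h3 : ‖coeff 1 r + coeff 1 g‖ ≤ ‖L - 1‖ * V := by
      refine norm_add_le_of_le ?_ hg1'.le
      refine (h.bound_r 1).trans ?_
      rw [pow_one]
      nlinarith [mul_pos hepos hV]
    have h4 : ‖- (L * coeff 1 u * (coeff 1 r + coeff 1 g) + coeff 2 g)‖ = ‖L - 1‖ * V ^ 2 := by
      rw [norm_neg, ← hg2]
      refine norm_eq_of_norm_sub_lt ?_
      rw [add_sub_cancel_right, norm_mul, norm_mul, hLn, one_mul, hg2]
      calc _ ≤ ‖coeff 1 u‖ * (‖L - 1‖ * V) := mul_le_mul_of_nonneg_left h3 (norm_nonneg _)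
        _ < V * (‖L - 1‖ * V) := mul_lt_mul_of_pos_right hu1' (by positivity)
        _ = _ := by ring
    have hp2' : ¬ p ∣ 2 := fun hd =>
      hp2 ((Nat.prime_dvd_prime_iff_eq hp.out Nat.prime_two).1 hd)
    rw [← e2, norm_mul, norm_pow_sub_one_of_not_dvd (p := p) hL1 hp2'] at h4
    rw [mul_left_cancel₀ hepos.ne' h4] at hu2
    exact le_of_sq_le_sq hu2 hD

/-- The smallest scale `W` fitting a degree 1 and a degree 2 bound at once, namely `max x √y`. -/
lemma exists_sq_max (x y : ℝ) (hx : 0 ≤ x) (hy : 0 ≤ y) :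
    ∃ W : ℝ, 0 ≤ W ∧ x ≤ W ∧ y ≤ W ^ 2 ∧ (x = W ∨ y = W ^ 2) := by
  refine ⟨max x (Real.sqrt y), le_max_of_le_left hx, le_max_left _ _, ?_, ?_⟩
  · calc y = Real.sqrt y ^ 2 := (Real.sq_sqrt hy).symm
      _ ≤ _ := pow_le_pow_left₀ (Real.sqrt_nonneg y) (le_max_right _ _) 2
  · rcases le_total x (Real.sqrt y) with h | h
    · right; rw [max_eq_right h, Real.sq_sqrt hy]
    · left; rw [max_eq_left h]

/-- `W` is the scale at which `G` has size `‖L - 1‖ ^ p` in degrees 1 and 2. Degree 2 gives the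
weaker gain, `‖L - 1‖ V ^ (2 p) ≤ ‖L - 1‖ ^ p W ^ 2`, which is the factor `‖L - 1‖ ^ s`. -/
lemma IsRenormState.step {s : ℕ} (hs : p = 2 * s + 1) (hs1 : 1 ≤ s) (hth : th < 1)
    (h : IsRenormState th V D L r g u) :
    ∃ (W : ℝ) (r' g' u' : PowerSeries K),
      IsRenormState th W (D ^ p) (L ^ p) r' g' u' ∧ V ^ p ≤ ‖L - 1‖ ^ s * W := by
  have hepos : 0 < ‖L - 1‖ := norm_pos_iff.2 (sub_ne_zero.2 h.ne_one)
  have hL1 := h.norm_le.trans_lt hth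
  have hth0 : 0 < th := hepos.trans_le h.norm_le
  have hV := h.pos
  obtain ⟨v, U, G, hv0, hv, hU, hG0, hveq, hUeq⟩ :=
    exists_renormalization (p := p) h.coeff_zero_u h.eqn
  set H := expand p hp.out.ne_zero G with hHdef
  obtain ⟨hvb, hHb⟩ := resonant_bounds (mu := 1) hV.le h.ne_one hL1 le_rfl
    (h.bound_r.mono (by gcongr) hV.le) h.coeff_zero_r (by simpa using h.bound_g)
    h.coeff_zero_g hG0 hv0 hv hveq
  rw [mul_one] at hHb
  have hfo := coeffBound_sub_logDeriv hV.le h.norm_le hth h.bound_r h.coeff_zero_r h.bound_g hv0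
    hvb hveq
  have hcart : IsCartierFixed p (logDeriv v) := isCartierFixed_logDeriv (by
    rw [← coeff_zero_eq_constantCoeff_apply, hv0])
  have hGk : ∀ k, coeff k G = coeff (p * k) H := fun k => (coeff_expand_mul p _ G k).symm
  -- exact size of `G` in degree `k` whenever `g` attains its bound there
  have hGeq : ∀ k, 0 < k → k < p → ‖coeff k g‖ = ‖L - 1‖ * V ^ k →
      ‖coeff k G‖ = ‖L - 1‖ * V ^ (p * k) := by
    intro k hk hkp hgk
    have hp3 : 3 ≤ p * k := by nlinarith
    -- Below degree `p` the series `H` vanishes, so `(L - 1) logDeriv v` must balance `-g`. The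
    -- Cartier relation then transports this size to degree `p * k`, where `g` is negligible.
    have hHk : coeff k H = 0 :=
      coeff_expand_of_not_dvd p _ _ (fun hd => absurd (Nat.le_of_dvd hk hd) (by omega))
    have h1 := hfo k
    rw [map_sub, map_sub, coeff_C_mul, hHk, zero_sub] at h1
    have h2 : ‖(L - 1) * coeff k (logDeriv v)‖ = ‖L - 1‖ * V ^ k := by
      rw [← hgk, ← norm_neg (coeff k g)]
      refine norm_eq_of_norm_sub_lt ?_
      rw [norm_sub_rev, norm_neg, hgk]
      refine h1.trans_lt ?_
      have : 0 < V ^ k := by positivity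
      rw [mul_assoc]
      exact mul_lt_mul_of_pos_left (by nlinarith) hepos
    rw [norm_mul] at h2
    have h3 : ‖coeff k (logDeriv v)‖ = V ^ k := mul_left_cancel₀ hepos.ne' h2
    have h4 : ‖(L - 1) * coeff (p * k) (logDeriv v)‖ = ‖L - 1‖ * V ^ (p * k) := by
      rw [norm_mul, hcart k, norm_pow, h3, ← pow_mul, mul_comm k p]
    rw [hGk, ← h4]
    refine norm_eq_of_norm_sub_lt ?_
    have h5 := hfo (p * k)
    rw [map_sub, map_sub, coeff_C_mul] at h5
    rw [show coeff (p * k) H - (L - 1) * coeff (p * k) (logDeriv v) =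
      (coeff (p * k) H - coeff (p * k) g - (L - 1) * coeff (p * k) (logDeriv v)) +
        coeff (p * k) g by ring, h4]
    refine (norm_add_le_of_le h5 (h.bound_g_tail _ hp3)).trans_lt ?_
    have : 0 < V ^ (p * k) := by positivity
    rw [mul_assoc]
    exact mul_lt_mul_of_pos_left (by nlinarith) hepos
  have hGb : ∀ k, ‖coeff k G‖ ≤ ‖L - 1‖ * V ^ (p * k) := fun k => by rw [hGk]; exact hHb _
  have hep : 0 < ‖L - 1‖ ^ p := by positivity
  obtain ⟨W, hW0, hW1, hW2, hW3⟩ := exists_sq_max (‖coeff 1 G‖ / ‖L - 1‖ ^ p)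
    (‖coeff 2 G‖ / ‖L - 1‖ ^ p) (by positivity) (by positivity)
  rw [div_le_iff₀ hep, mul_comm] at hW1 hW2
  rw [div_eq_iff hep.ne', div_eq_iff hep.ne', mul_comm W, mul_comm (W ^ 2)] at hW3
  have hes : 0 < ‖L - 1‖ ^ s := by positivity
  have hpe : ‖L - 1‖ ^ p = ‖L - 1‖ * (‖L - 1‖ ^ s) ^ 2 := by
    rw [hs, ← pow_mul, mul_comm s 2, pow_succ]; ring
  have hWV : V ^ p ≤ ‖L - 1‖ ^ s * W := by
    have hes1 : ‖L - 1‖ ^ s ≤ 1 := pow_le_one₀ (norm_nonneg _) hL1.le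
    rcases h.norm_eq with h1 | h1
    · have h2 := hGeq 1 one_pos hp.out.one_lt (by simpa using h1)
      rw [mul_one] at h2
      rw [h2, hpe, mul_assoc] at hW1
      have := le_of_mul_le_mul_left hW1 hepos
      refine this.trans ?_
      rw [pow_two, mul_assoc]
      exact mul_le_of_le_one_left (by positivity) hes1
    · have h2 := hGeq 2 two_pos (by omega) h1
      rw [h2, hpe, mul_assoc] at hW2
      have := le_of_mul_le_mul_left hW2 hepos
      rw [pow_mul, ← mul_pow] at this
      exact le_of_sq_le_sq this (by positivity)
  have hWpos : 0 < W := by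
    have : 0 < V ^ p := by positivity
    by_contra hcon
    have : W = 0 := le_antisymm (not_lt.1 hcon) hW0
    rw [this, mul_zero] at hWV
    linarith
  have hnorm := norm_pow_char_sub_one (p := p) L
  have hepe : ‖L - 1‖ ^ p ≤ ‖L - 1‖ :=
    pow_le_of_le_one (norm_nonneg _) hL1.le hp.out.ne_zero
  have hVW : V ^ p ≤ W := hWV.trans
    (mul_le_of_le_one_left hW0 (pow_le_one₀ (norm_nonneg _) hL1.le))
  have htail : ∀ k, 3 ≤ k → ‖coeff k G‖ ≤ ‖L - 1‖ ^ p * th * W ^ k := by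
    intro k hk
    obtain ⟨m, rfl⟩ : ∃ m, k = m + 3 := ⟨k - 3, by omega⟩
    refine (hGb _).trans ?_
    -- Three of the factors `V ^ p ≤ ‖L - 1‖ ^ s W` suffice: `1 + 3 s = p + s`, and the surplus `‖L
    -- - 1‖ ^ s` is at most `th`.
    have h1 : V ^ (p * (m + 3)) ≤ (‖L - 1‖ ^ s) ^ 3 * W ^ (m + 3) := by
      rw [pow_mul]
      calc (V ^ p) ^ (m + 3) ≤ (‖L - 1‖ ^ s * W) ^ (m + 3) := by gcongr
        _ = (‖L - 1‖ ^ s) ^ (m + 3) * W ^ (m + 3) := mul_pow _ _ _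
        _ ≤ _ := by
          refine mul_le_mul_of_nonneg_right ?_ (by positivity)
          exact pow_le_pow_of_le_one hes.le (pow_le_one₀ (norm_nonneg _) hL1.le) (by omega)
    have h2 : ‖L - 1‖ ^ s ≤ th :=
      (pow_le_of_le_one (norm_nonneg _) hL1.le (by omega)).trans h.norm_le
    calc ‖L - 1‖ * V ^ (p * (m + 3)) ≤ ‖L - 1‖ * ((‖L - 1‖ ^ s) ^ 3 * W ^ (m + 3)) := by gcongr
      _ = ‖L - 1‖ ^ p * (‖L - 1‖ ^ s) * W ^ (m + 3) := by rw [hpe]; ring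
      _ ≤ _ := by gcongr
  refine ⟨W, map (frobenius K p) r, G, U, ⟨?_, ?_, hWpos, ?_, hG0, ?_, hUeq, ?_, ?_, ?_, ?_, ?_⟩,
    hWV⟩
  · rw [← sub_ne_zero, ← norm_pos_iff, hnorm]; exact hep
  · rw [hnorm]; exact hepe.trans h.norm_le
  · rw [coeff_map, h.coeff_zero_r, map_zero]
  · rw [hU, mul_zero, h.coeff_zero_u]
  · intro k
    rw [coeff_map, frobenius_def, norm_pow, hnorm]
    calc ‖coeff k r‖ ^ p ≤ (‖L - 1‖ * th * V ^ k) ^ p := by gcongr; exact h.bound_r k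
      _ = ‖L - 1‖ ^ p * th ^ p * (V ^ p) ^ k := by rw [mul_pow, mul_pow]; ring
      _ ≤ _ := by
        gcongr
        exact pow_le_of_le_one hth0.le hth.le hp.out.ne_zero
  · intro k
    rw [hnorm]
    rcases Nat.lt_or_ge k 3 with hk | hk
    · interval_cases k
      · rw [hG0, norm_zero]; positivity
      · simpa using hW1
      · exact hW2
    · refine (htail k hk).trans ?_
      refine mul_le_mul_of_nonneg_right ?_ (by positivity)
      exact mul_le_of_le_one_right hep.le hth.le
  · rw [hnorm]; exact htail
  · rw [hnorm, pow_two] ; simpa [pow_two] using hW3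
  · intro k; rw [hU, ← pow_mul]; exact h.bound_u _

theorem IsRenormState.false {s : ℕ} (hs : p = 2 * s + 1) (hs1 : 1 ≤ s) (hth : th < 1)
    (h : IsRenormState th V D L r g u) : False := by
  have hepos : 0 < ‖L - 1‖ := norm_pos_iff.2 (sub_ne_zero.2 h.ne_one)
  have hL1 := h.norm_le.trans_lt hth
  have hp0 := hp.out.pos
  have hp2 : p ≠ 2 := by omega
  -- At stage `n` the distance to 1 is `‖L - 1‖ ^ (p ^ n)`. Each stage contributes at least one such
  -- factor, hence the exponent `n * p ^ n` after normalization.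
  have hiter : ∀ n : ℕ, ∃ (W : ℝ) (r' g' u' : PowerSeries K),
      IsRenormState th W (D ^ p ^ n) (L ^ p ^ n) r' g' u' ∧
        (V ^ p ^ n) ^ p ≤ (‖L - 1‖ ^ (n * p ^ n)) * W ^ p := by
    intro n
    induction n with
    | zero => exact ⟨V, r, g, u, by simpa using h, by simp⟩
    | succ n ih =>
      obtain ⟨W, r', g', u', hst, hW⟩ := ih
      obtain ⟨W', r'', g'', u'', hst', hW'⟩ := hst.step hs hs1 hth
      have hn : ‖L ^ p ^ n - 1‖ = ‖L - 1‖ ^ p ^ n := by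
        rw [← norm_pow, sub_pow_char_pow, one_pow]
      rw [hn] at hW'
      refine ⟨W', r'', g'', u'', by simpa [← pow_mul, ← pow_succ] using hst', ?_⟩
      have hV := h.pos
      have hWp := hst.pos
      have hWp' := hst'.pos
      have h1 : W ^ p ≤ ‖L - 1‖ ^ p ^ n * W' := by
        refine hW'.trans (mul_le_mul_of_nonneg_right ?_ hWp'.le)
        exact pow_le_of_le_one (by positivity) (pow_le_one₀ (norm_nonneg _) hL1.le) (by omega)
      calc (V ^ p ^ (n + 1)) ^ p = ((V ^ p ^ n) ^ p) ^ p := by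
            rw [← pow_mul, ← pow_mul, ← pow_mul, pow_succ, mul_assoc]
        _ ≤ (‖L - 1‖ ^ (n * p ^ n) * W ^ p) ^ p := by gcongr
        _ ≤ (‖L - 1‖ ^ (n * p ^ n) * (‖L - 1‖ ^ p ^ n * W')) ^ p := by gcongr
        _ = ‖L - 1‖ ^ ((n + 1) * p ^ (n + 1)) * W' ^ p := by
            rw [← mul_assoc, ← pow_add, mul_pow, ← pow_mul]
            congr 2
            ring
  have hV := h.pos
  have hD : 0 < D := hV.trans_le (h.le hp2 hth)
  -- compare with the bound `W ≤ D ^ p ^ n`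
  have hbound : ∀ n : ℕ, V ^ p ≤ ‖L - 1‖ ^ n * D ^ p := by
    intro n
    obtain ⟨W, r', g', u', hst, hW⟩ := hiter n
    have h1 := hst.le hp2 hth
    have h2 : (V ^ p) ^ p ^ n ≤ (‖L - 1‖ ^ n * D ^ p) ^ p ^ n := by
      calc (V ^ p) ^ p ^ n = (V ^ p ^ n) ^ p := by rw [← pow_mul, ← pow_mul, mul_comm]
        _ ≤ ‖L - 1‖ ^ (n * p ^ n) * W ^ p := hW
        _ ≤ ‖L - 1‖ ^ (n * p ^ n) * (D ^ p ^ n) ^ p := by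
          have := hst.pos
          gcongr
        _ = _ := by rw [mul_pow, ← pow_mul, ← pow_mul, ← pow_mul, mul_comm p (p ^ n)]
    exact le_of_pow_le_pow_left₀ (pow_pos hp0 n).ne' (by positivity) h2
  obtain ⟨n, hn⟩ := exists_pow_lt_of_lt_one (show 0 < V ^ p / D ^ p by positivity) hL1
  rw [lt_div_iff₀ (by positivity)] at hn
  exact absurd (hbound n) (not_le.2 hn)

end State

end PowerSeries

/-! ### A criterion for divergence of the linearization -/

namespace PowerSeries

section Criterion

variable {K : Type*} [NormedField K] [IsUltrametricDist K] {mu V D : ℝ} {L : K}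
  {r u : PowerSeries K} {p : ℕ} [hp : Fact p.Prime] [CharP K p]

/-- If `L * X * (1 + r)` is close to `L * X` and its dominant resonant term has degree `p + 1`
or `2 * p + 1`, then the cohomological equation `u(L X (1 + r)) (1 + r) = u` has no convergent
solution. -/
theorem false_of_dominant_resonance (hp5 : 5 ≤ p) (hL : L ≠ 1) (hV : 0 < V)
    (hmu : ‖L - 1‖ ≤ mu) (hmu1 : mu < 1) (hr0 : coeff 0 r = 0)
    (hr : CoeffBound (‖L - 1‖ * mu) V r)
    (hdom : ‖coeff p r‖ = ‖L - 1‖ * mu * V ^ p ∨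
      ‖coeff (p * 2) r‖ = ‖L - 1‖ * mu * V ^ (p * 2) ∧ mu = ‖L - 1‖)
    (hu0 : coeff 0 u = 1) (hu : ∀ k, ‖coeff k u‖ ≤ D ^ k)
    (heq : u.subst (twist L r) * (1 + r) = u) : False := by
  obtain ⟨s, hs⟩ : ∃ s, p = 2 * s + 1 :=
    hp.out.odd_of_ne_two (by omega)
  have hs2 : 2 ≤ s := by omega
  have hepos : 0 < ‖L - 1‖ := norm_pos_iff.2 (sub_ne_zero.2 hL)
  have hmu0 : 0 < mu := hepos.trans_le hmu
  have hL1 : ‖L - 1‖ < 1 := hmu.trans_lt hmu1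
  obtain ⟨v, U, G, hv0, hv, hU, hG0, hveq, hUeq⟩ :=
    exists_renormalization (p := p) hu0 heq
  obtain ⟨hvb, hHb⟩ := resonant_bounds hV.le hL hL1 hmu1.le hr hr0 hr hr0 hG0 hv0 hv hveq
  set H := expand p hp.out.ne_zero G with hHdef
  have hGk : ∀ k, coeff k G = coeff (p * k) H := fun k => (coeff_expand_mul p _ G k).symm
  have hGb : ∀ k, ‖coeff k G‖ ≤ ‖L - 1‖ * mu * (V ^ p) ^ k := fun k => by
    rw [hGk, ← pow_mul]; exact hHb _
  have hGeq : ∀ k, 0 < k → ‖coeff (p * k) r‖ = ‖L - 1‖ * mu * V ^ (p * k) →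
      ‖coeff k G‖ = ‖L - 1‖ * mu * (V ^ p) ^ k := by
    intro k hk hrk
    -- In degree `p * k` the factor `v` vanishes, so `G` inherits the coefficient of `r` up to a
    -- relative error `mu < 1`.
    have h1 := norm_coeff_sub_le_of_resonant hV.le hL1 hmu1.le hr hr0 hr hv0 hvb hHb hveq
      (hv (p * k) (by have := hp.out.pos; positivity) (dvd_mul_right p k))
    rw [← pow_mul, ← hrk, hGk]
    refine norm_eq_of_norm_sub_lt (h1.trans_lt ?_)
    rw [hrk]
    have : 0 < ‖L - 1‖ * mu * V ^ (p * k) := by positivity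
    nlinarith
  obtain ⟨W, hW0, hW1, hW2, hW3⟩ := exists_sq_max (‖coeff 1 G‖ / ‖L - 1‖ ^ p)
    (‖coeff 2 G‖ / ‖L - 1‖ ^ p) (by positivity) (by positivity)
  have hep : 0 < ‖L - 1‖ ^ p := by positivity
  rw [div_le_iff₀ hep, mul_comm] at hW1 hW2
  rw [div_eq_iff hep.ne', div_eq_iff hep.ne', mul_comm W, mul_comm (W ^ 2)] at hW3
  set e := ‖L - 1‖ with he
  set q := V ^ p with hq
  have hqpos : 0 < q := by positivity
  obtain ⟨t, rfl⟩ : ∃ t, s = t + 2 := ⟨s - 2, by omega⟩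
  have hle : ∀ {m n : ℕ}, n ≤ m → e ^ m ≤ e ^ n := fun h => pow_le_pow_of_le_one hepos.le hL1.le h
  -- Here `p = 2 t + 5`. Two powers of `e` are lost against `e ^ p`, because `G` starts with size `e
  -- * mu` and `mu ≥ e`.
  have hB : q ^ 2 ≤ e ^ (2 * t + 3) * W ^ 2 := by
    rcases hdom with h | ⟨h, hmue⟩
    · have h1 := hGeq 1 one_pos (by simpa using h)
      rw [h1, pow_one] at hW1
      have h2 : e ^ 2 * q ≤ e ^ 2 * (e ^ (2 * t + 3) * W) := by
        calc e ^ 2 * q ≤ e * mu * q := by rw [pow_two]; gcongr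
          _ ≤ e ^ p * W := hW1
          _ = _ := by rw [hs]; ring
      have h3 := le_of_mul_le_mul_left h2 (by positivity)
      calc q ^ 2 ≤ (e ^ (2 * t + 3) * W) ^ 2 := by gcongr
        _ = e ^ (2 * (2 * t + 3)) * W ^ 2 := by rw [mul_pow, ← pow_mul]; ring
        _ ≤ _ := mul_le_mul_of_nonneg_right (hle (by omega)) (by positivity)
    · have h1 := hGeq 2 two_pos h
      rw [h1, hmue] at hW2
      refine le_of_mul_le_mul_left (a := e ^ 2) ?_ (by positivity)
      calc e ^ 2 * q ^ 2 = e * e * q ^ 2 := by ring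
        _ ≤ e ^ p * W ^ 2 := hW2
        _ = _ := by rw [hs]; ring
  have hA : q ≤ e ^ (t + 1) * W := by
    refine le_of_sq_le_sq ?_ (by positivity)
    refine hB.trans ?_
    rw [mul_pow, ← pow_mul]
    exact mul_le_mul_of_nonneg_right (hle (by omega)) (by positivity)
  have hqW : q ≤ W := hA.trans (mul_le_of_le_one_left hW0 (pow_le_one₀ hepos.le hL1.le))
  have hWpos : 0 < W := hqpos.trans_le hqW
  have htail : ∀ k, 3 ≤ k → ‖coeff k G‖ ≤ e ^ p * mu * W ^ k := by
    intro k hk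
    obtain ⟨m, rfl⟩ : ∃ m, k = m + 3 := ⟨k - 3, by omega⟩
    refine (hGb _).trans ?_
    -- The available exponent `(t + 1) + (2 t + 3)` must reach `p - 1 = 2 t + 4`; this requires `t ≥
    -- 0`, that is `p ≥ 5`.
    have h1 : q ^ (m + 3) ≤ e ^ (2 * t + 4) * W ^ (m + 3) := by
      calc q ^ (m + 3) = q ^ m * q * q ^ 2 := by ring
        _ ≤ W ^ m * (e ^ (t + 1) * W) * (e ^ (2 * t + 3) * W ^ 2) := by gcongr
        _ = e ^ (3 * t + 4) * W ^ (m + 3) := by ring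
        _ ≤ _ := mul_le_mul_of_nonneg_right (hle (by omega)) (by positivity)
    calc e * mu * q ^ (m + 3) ≤ e * mu * (e ^ (2 * t + 4) * W ^ (m + 3)) := by gcongr
      _ = _ := by rw [hs]; ring
  have hnorm : ‖L ^ p - 1‖ = e ^ p := norm_pow_char_sub_one (p := p) L
  refine IsRenormState.false (p := p) (s := t + 2) (th := mu) (V := W) (D := D ^ p) (L := L ^ p)
    (r := map (frobenius K p) r) (g := G) (u := U) hs (by omega) hmu1
    ⟨?_, ?_, hWpos, ?_, hG0, ?_, hUeq, ?_, ?_, ?_, ?_, ?_⟩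
  · rw [← sub_ne_zero, ← norm_pos_iff, hnorm]; exact hep
  · rw [hnorm]; exact (pow_le_of_le_one hepos.le hL1.le hp.out.ne_zero).trans hmu
  · rw [coeff_map, hr0, map_zero]
  · rw [hU, mul_zero, hu0]
  · intro k
    rw [coeff_map, frobenius_def, norm_pow, hnorm]
    calc ‖coeff k r‖ ^ p ≤ (e * mu * V ^ k) ^ p := by gcongr; exact hr k
      _ = e ^ p * mu ^ p * q ^ k := by rw [mul_pow, mul_pow]; ring
      _ ≤ _ := by
        gcongr
        exact pow_le_of_le_one hmu0.le hmu1.le hp.out.ne_zero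
  · intro k
    rw [hnorm]
    rcases Nat.lt_or_ge k 3 with hk | hk
    · interval_cases k
      · rw [hG0, norm_zero]; positivity
      · simpa using hW1
      · exact hW2
    · refine (htail k hk).trans ?_
      refine mul_le_mul_of_nonneg_right ?_ (by positivity)
      exact mul_le_of_le_one_right hep.le hmu1.le
  · rw [hnorm]; exact htail
  · rw [hnorm]; exact hW3
  · intro k; rw [hU, ← pow_mul]; exact hu _

end Criterion

end PowerSeries

/-! ### Coordinate changes and linearizability -/

namespace PowerSeries

section Coordinates

variable {K : Type*} [Field K]

lemma exists_eq_twist {g : PowerSeries K} {L : K} (hL : L ≠ 0) (h0 : coeff 0 g = 0)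
    (h1 : coeff 1 g = L) : ∃ r, coeff 0 r = 0 ∧ g = twist L r := by
  obtain ⟨d, hd⟩ := X_dvd_iff.2 (show constantCoeff g = 0 by
    rwa [← coeff_zero_eq_constantCoeff_apply])
  have hd0 : coeff 0 d = L := by rw [← h1, hd, coeff_succ_X_mul]
  refine ⟨C L⁻¹ * d - 1, ?_, ?_⟩
  · rw [map_sub, coeff_C_mul, hd0, inv_mul_cancel₀ hL, coeff_zero_one, sub_self]
  · rw [hd, twist, add_sub_cancel, show C L * X * (C L⁻¹ * d) = (C L * C L⁻¹) * (X * d) by ring,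
      ← map_mul, mul_inv_cancel₀ hL, map_one, one_mul]

lemma coeff_one_subst_twist (L : K) {r : PowerSeries K} (hr0 : coeff 0 r = 0)
    (a : PowerSeries K) : coeff 1 (a.subst (twist L r)) = coeff 1 a * L := by
  rw [coeff_zero_eq_constantCoeff_apply] at hr0
  rw [coeff_subst_twist]; simp [Finset.sum_range_succ, coeff_one, hr0]

/-- The conjugated map is `psi⁻¹ ∘ g`, whose linear coefficient is still `L`. -/
lemma exists_subst_twist_eq {psi g : PowerSeries K} {L : K} (hL : L ≠ 0)
    (hpsi0 : coeff 0 psi = 0) (hpsi1 : coeff 1 psi = 1) (h0 : coeff 0 g = 0)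
    (h1 : coeff 1 g = L) : ∃ r, coeff 0 r = 0 ∧ psi.subst (twist L r) = g := by
  obtain ⟨t, ht0, rfl⟩ := exists_eq_twist hL h0 h1
  have hu : IsUnit (coeff 1 psi) := by rw [hpsi1]; exact isUnit_one
  have hc : constantCoeff psi = 0 := by rwa [← coeff_zero_eq_constantCoeff_apply]
  set q := psi.substInvOfIsUnit hu with hq
  have hqs : HasSubst q := HasSubst.substInvOfIsUnit psi hu
  have hq0 : coeff 0 q = 0 := by
    rw [coeff_zero_eq_constantCoeff_apply]; exact constantCoeff_substInvOfIsUnit psi hu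
  have hq1 : coeff 1 q = 1 := by
    rw [hq, coeff_one_substInvOfIsUnit]
    have : hu.unit = 1 := by ext; simp [hpsi1]
    rw [this]; simp
  have hright : psi.subst q = X := subst_substInvOfIsUnit_right psi hc hu
  obtain ⟨r, hr0, hr⟩ := exists_eq_twist (g := q.subst (twist L t)) hL
    (by rw [coeff_zero_subst_twist, hq0]) (by rw [coeff_one_subst_twist L ht0, hq1, one_mul])
  refine ⟨r, hr0, ?_⟩
  rw [← hr, ← subst_comp_subst_apply hqs (hasSubst_twist L t), hright,
    subst_X (hasSubst_twist L t)]

/-- Substituting `T` into the algebraic equation of `psi` gives one for `T`, without expanding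
`psi⁻¹`. -/
lemma subst_mul_one_sub {psi T g : PowerSeries K} {α : K} (hT : HasSubst T)
    (h : psi.subst T = g) (h1 : psi * (1 - C α * X) = X) : g * (1 - C α * T) = T := by
  have h2 := congrArg (fun a : PowerSeries K => (a.subst T : PowerSeries K)) h1
  have hC : ∀ x : K, (C x).subst T = (C x : PowerSeries K) := fun x => subst_C x
  have h3 : (1 : PowerSeries K).subst T = (1 : PowerSeries K) := by
    rw [← map_one (C : K →+* PowerSeries K), hC]
  beta_reduce at h2
  rwa [subst_mul hT, subst_sub hT, subst_mul hT, subst_X hT, hC, h, h3] at h2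

lemma sq_mul_subst_one_sub {psi T g : PowerSeries K} {β : K} (hT : HasSubst T)
    (h : psi.subst T = g) (h1 : psi ^ 2 * (1 - C β * X ^ 2) = X ^ 2) :
    g ^ 2 * (1 - C β * T ^ 2) = T ^ 2 := by
  have h2 := congrArg (fun a : PowerSeries K => (a.subst T : PowerSeries K)) h1
  have hC : ∀ x : K, (C x).subst T = (C x : PowerSeries K) := fun x => subst_C x
  have h3 : (1 : PowerSeries K).subst T = (1 : PowerSeries K) := by
    rw [← map_one (C : K →+* PowerSeries K), hC]
  beta_reduce at h2
  rwa [subst_mul hT, subst_sub hT, subst_mul hT, subst_pow hT, subst_pow hT, subst_X hT, hC, h,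
    h3] at h2

end Coordinates

/-! ### Transport of convergent linearizations to a new coordinate -/

section Convergence

variable {K : Type*} [NormedField K] [IsUltrametricDist K]

lemma CoeffBound.pow {V : ℝ} {a : PowerSeries K} (hV : 0 ≤ V) (h : CoeffBound 1 V a) (j : ℕ) :
    CoeffBound 1 V (a ^ j) := by
  induction j with
  | zero => simpa using coeffBound_one hV
  | succ j ih => rw [pow_succ]; simpa using ih.mul h hV

lemma norm_coeff_subst_le {h psi : PowerSeries K} {D W : ℝ} (hW : 0 ≤ W) (hD : 1 ≤ D)
    (hh : ∀ k, ‖coeff k h‖ ≤ D ^ k) (hpsi : CoeffBound 1 W psi) (hpsi0 : coeff 0 psi = 0) (k : ℕ) :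
    ‖coeff k (h.subst psi)‖ ≤ (D * W) ^ k := by
  have hc : constantCoeff psi = 0 := by rwa [← coeff_zero_eq_constantCoeff_apply]
  have hz : ∀ j, k < j → coeff k (psi ^ j) = 0 := by
    intro j hj
    obtain ⟨d, hd⟩ := X_dvd_iff.2 hc
    rw [hd, mul_pow, coeff_X_pow_mul', if_neg (by omega)]
  rw [coeff_subst' (HasSubst.of_constantCoeff_zero' hc),
    finsum_eq_sum_of_support_subset (s := Finset.range (k + 1))]
  · refine IsUltrametricDist.norm_sum_le_of_forall_le_of_nonneg (by positivity) fun j hj => ?_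
    have hj' := Finset.mem_range.1 hj
    rw [smul_eq_mul, norm_mul, mul_pow]
    refine mul_le_mul ((hh j).trans (pow_le_pow_right₀ hD (by omega))) ?_ (norm_nonneg _)
      (by positivity)
    simpa using hpsi.pow hW j k
  · intro j hj
    by_contra hcon
    refine hj ?_
    simp only [Finset.coe_range, Set.mem_Iio, not_lt] at hcon
    simp only [hz j (by omega), smul_zero]

/-- In a coordinate where `f` becomes `L * X * (1 + r)`, a linearization of `f` yields a convergent
solution of the cohomological equation. -/
lemma exists_cohomological_solution {f h psi r : PowerSeries K} {L : K} {D W : ℝ} (hL : L ≠ 0)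
    (hf0 : coeff 0 f = 0) (hh0 : coeff 0 h = 0) (hh1 : coeff 1 h ≠ 0)
    (hlin : h.subst f = C L * h) (hD : 1 ≤ D) (hh : ∀ k, ‖coeff k h‖ ≤ D ^ k)
    (hpsi0 : coeff 0 psi = 0) (hpsi1 : coeff 1 psi = 1) (hW : 0 < W) (hpsi : CoeffBound 1 W psi)
    (hconj : psi.subst (twist L r) = f.subst psi) :
    ∃ (u : PowerSeries K) (B : ℝ), coeff 0 u = 1 ∧ (∀ k, ‖coeff k u‖ ≤ B ^ k) ∧
      u.subst (twist L r) * (1 + r) = u := by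
  have hpsis : HasSubst psi := HasSubst.of_constantCoeff_zero' (by
    rwa [← coeff_zero_eq_constantCoeff_apply])
  have hfs : HasSubst f := HasSubst.of_constantCoeff_zero' (by
    rwa [← coeff_zero_eq_constantCoeff_apply])
  have hT := hasSubst_twist L r
  set H : PowerSeries K := h.subst psi with hH
  have hHlin : H.subst (twist L r) = C L * H := by
    rw [hH, subst_comp_subst_apply hpsis hT, hconj, ← subst_comp_subst_apply hfs hpsis, hlin,
      subst_mul hpsis, subst_C]
    rfl
  have hHb : ∀ k, ‖coeff k H‖ ≤ (D * W) ^ k :=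
    norm_coeff_subst_le hW.le hD hh hpsi hpsi0
  obtain ⟨t, ht0, ht⟩ := exists_eq_twist one_ne_zero hpsi0 hpsi1
  have hH0 : coeff 0 H = 0 := by rw [hH, ht, coeff_zero_subst_twist, hh0]
  have hH1 : coeff 1 H = coeff 1 h := by rw [hH, ht, coeff_one_subst_twist 1 ht0, mul_one]
  set b := coeff 1 h
  obtain ⟨t', ht'0, ht'⟩ := exists_eq_twist hh1 hH0 hH1
  have hbpos : 0 < ‖b‖ := norm_pos_iff.2 hh1
  refine ⟨1 + t', D * W * max 1 (D * W / ‖b‖), ?_, ?_, ?_⟩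
  · rw [map_add, ht'0, coeff_zero_one, add_zero]
  · intro k
    rcases Nat.eq_zero_or_pos k with rfl | hk
    · rw [map_add, ht'0, coeff_zero_one, add_zero, norm_one, pow_zero]
    have h1 : coeff (k + 1) H = b * coeff k (1 + t') := by
      rw [ht', twist, mul_assoc, coeff_C_mul, coeff_succ_X_mul]
    have h2 : ‖coeff k (1 + t')‖ = ‖coeff (k + 1) H‖ / ‖b‖ := by
      rw [h1, norm_mul, mul_div_cancel_left₀ _ hbpos.ne']
    rw [h2, mul_pow]
    calc ‖coeff (k + 1) H‖ / ‖b‖ ≤ (D * W) ^ (k + 1) / ‖b‖ := by gcongr; exact hHb _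
      _ = (D * W) ^ k * (D * W / ‖b‖) := by ring
      _ ≤ (D * W) ^ k * (max 1 (D * W / ‖b‖)) ^ k := by
        gcongr
        exact (le_max_right _ _).trans (le_self_pow₀ (le_max_left _ _) hk.ne')
  -- With `H = b X u`, the relation `H(T) = L H` is the cohomological equation multiplied by `b L
  -- X`.
  · have hne : (C b * C L * X : PowerSeries K) ≠ 0 := by
      refine mul_ne_zero (mul_ne_zero ?_ ?_) X_ne_zero
      · rwa [Ne, map_eq_zero_iff _ C_injective]
      · rwa [Ne, map_eq_zero_iff _ C_injective]
    refine mul_left_cancel₀ hne ?_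
    rw [ht', show twist b t' = C b * X * (1 + t') from rfl, subst_mul hT, subst_mul hT, subst_X hT, subst_C] at hHlin
    change C b * twist L r * _ = _ at hHlin
    rw [show C b * twist L r = C b * (C L * X * (1 + r)) from rfl] at hHlin
    linear_combination hHlin

end Convergence

end PowerSeries

/-! ### Consequences of analytic linearizability -/

section Linearizable

variable {K : Type*} [NormedField K]

lemma IsLocallyAnalytic.exists_pow_bound {h : PowerSeries K} (hh : IsLocallyAnalytic h)
    (h0 : PowerSeries.coeff 0 h = 0) {x : K} (hx0 : x ≠ 0) (hx : ‖x‖ < 1) :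
    ∃ D : ℝ, 1 ≤ D ∧ ∀ k, ‖PowerSeries.coeff k h‖ ≤ D ^ k := by
  obtain ⟨ρ, hρ, hsum⟩ := hh
  -- A power of `x` is a nonzero point of the disc; the terms of the series there are bounded.
  obtain ⟨n, hn⟩ := exists_pow_lt_of_lt_one hρ hx
  have hz := (hsum (x ^ n) (by rwa [norm_pow])).tendsto_atTop_zero
  obtain ⟨M, hM⟩ := (hz.norm.bddAbove_range)
  have hpos : 0 < ‖x ^ n‖ := norm_pos_iff.2 (pow_ne_zero n hx0)
  refine ⟨max 1 (max 1 M / ‖x ^ n‖), le_max_left _ _, fun k => ?_⟩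
  rcases Nat.eq_zero_or_pos k with rfl | hk
  · rw [h0]; simp
  have h1 : ‖PowerSeries.coeff k h‖ * ‖x ^ n‖ ^ k ≤ M := by
    have := hM ⟨k, rfl⟩
    simpa [norm_mul, norm_pow] using this
  calc ‖PowerSeries.coeff k h‖ ≤ M / ‖x ^ n‖ ^ k := by rwa [le_div_iff₀ (by positivity)]
    _ ≤ (max 1 M) ^ k / ‖x ^ n‖ ^ k := by
      gcongr
      exact (le_max_right _ _).trans (le_self_pow₀ (le_max_left _ _) hk.ne')
    _ = (max 1 M / ‖x ^ n‖) ^ k := by rw [div_pow]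
    _ ≤ _ := by gcongr; exact le_max_right _ _

open PowerSeries in
lemma IsLocallyLinearizable.exists_linearization {f : PowerSeries K}
    (hf : IsLocallyLinearizable f) (hf0 : coeff 0 f = 0) :
    ∃ h : PowerSeries K, coeff 0 h = 0 ∧ coeff 1 h ≠ 0 ∧ IsLocallyAnalytic h ∧
      h.subst f = C (coeff 1 f) * h := by
  obtain ⟨h, hb, h0, han, heq⟩ := hf
  have hfs : HasSubst f := HasSubst.of_constantCoeff_zero' (by
    rwa [← coeff_zero_eq_constantCoeff_apply])
  have hhs : HasSubst h := HasSubst.of_constantCoeff_zero' h0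
  have hq : HasSubst (h.substInvOfIsUnit hb) := HasSubst.substInvOfIsUnit h hb
  refine ⟨h, by rwa [coeff_zero_eq_constantCoeff_apply], hb.ne_zero, han, ?_⟩
  have h1 := congrArg (fun a : PowerSeries K => a.subst h) heq
  beta_reduce at h1
  rw [subst_comp_subst_apply hq hhs, subst_substInvOfIsUnit_left h h0 hb, X_subst,
    subst_mul hhs, subst_C, subst_X hhs] at h1
  exact h1

end Linearizable

/-! ### Cubic polynomials -/

namespace PowerSeries

section Cubic

variable {K : Type*} [NormedField K]

lemma CoeffBound.mono_right {V W : ℝ} {c : ℝ} {a : PowerSeries K} (h : CoeffBound c V a)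
    (hV : 0 ≤ V) (hVW : V ≤ W) : CoeffBound c W a :=
  fun k => (h k).trans (mul_le_mul_of_nonneg_left (pow_le_pow_left₀ hV hVW k) h.nonneg)

/-- The polynomial `(1 + ε) X + ε α X ^ 2 + ε β X ^ 3`. -/
noncomputable def cubic (ε α β : K) : PowerSeries K :=
  C (1 + ε) * X + C (ε * α) * X ^ 2 + C (ε * β) * X ^ 3

lemma coeff_zero_cubic (ε α β : K) : coeff 0 (cubic ε α β) = 0 := by
  simp [cubic]

lemma coeff_one_cubic (ε α β : K) : coeff 1 (cubic ε α β) = 1 + ε := by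
  rw [cubic, map_add, map_add, coeff_C_mul, coeff_C_mul, coeff_C_mul, coeff_one_X, coeff_X_pow,
    coeff_X_pow]
  simp

lemma subst_cubic {ε α β : K} {psi : PowerSeries K} (h : coeff 0 psi = 0) :
    (cubic ε α β).subst psi = psi * (1 + C ε * (1 + C α * psi + C β * psi ^ 2)) := by
  have hs : HasSubst psi := HasSubst.of_constantCoeff_zero' (by
    rwa [← coeff_zero_eq_constantCoeff_apply])
  have hC : ∀ x : K, (C x).subst psi = (C x : PowerSeries K) := fun x => subst_C x
  rw [cubic, subst_add hs, subst_add hs, subst_mul hs, subst_mul hs, subst_mul hs, subst_pow hs,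
    subst_pow hs, subst_X hs, hC, hC, hC, map_mul, map_mul, map_add, map_one]
  ring

lemma coeff_geometric_sq {β : K} {S : PowerSeries K} (hS : S * (1 - C β * X ^ 2) = 1) (n : ℕ) :
    coeff (2 * n) S = β ^ n ∧ coeff (2 * n + 1) S = 0 := by
  have hS' : S = 1 + C β * (X ^ 2 * S) := by linear_combination hS
  have hrec : ∀ k, coeff (k + 2) S = β * coeff k S := by
    intro k
    conv_lhs => rw [hS']
    rw [map_add, coeff_one, if_neg (by omega), zero_add, coeff_C_mul, coeff_X_pow_mul]
  induction n with
  | zero =>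
    constructor
    · rw [hS']; simp
    · conv_lhs => rw [hS']
      rw [map_add, coeff_one, if_neg (by omega), zero_add, coeff_C_mul, coeff_X_pow_mul',
        if_neg (by omega), mul_zero]
  | succ n ih =>
    constructor
    · rw [show 2 * (n + 1) = 2 * n + 2 by ring, hrec, ih.1, pow_succ, mul_comm]
    · rw [show 2 * (n + 1) + 1 = 2 * n + 1 + 2 by ring, hrec, ih.2, mul_zero]

variable {p : ℕ} [hp : Fact p.Prime] [CharP K p]

/-- `catalan n` divides the central binomial coefficient, hence `(2 n)!`, which is prime to `p`. -/
lemma norm_catalan_eq_one {n : ℕ} (hn : 2 * n < p) : ‖(catalan n : K)‖ = 1 := by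
  refine norm_natCast_eq_one_of_not_dvd (p := p) fun hd => ?_
  have h1 : p ∣ n.centralBinom := by
    rw [← succ_mul_catalan_eq_centralBinom]; exact hd.mul_left _
  have h2 : p ∣ (2 * n).factorial := by
    rw [← Nat.choose_mul_factorial_mul_factorial (show n ≤ 2 * n by omega)]
    exact (h1.mul_right _).mul_right _
  exact absurd ((hp.out.dvd_factorial).1 h2) (by omega)

variable [IsUltrametricDist K]

lemma CoeffBound.X_mul {V : ℝ} {a : PowerSeries K} (h : CoeffBound 1 V a) (hV : 0 ≤ V) :
    CoeffBound 1 (max 1 V) (X * a) := by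
  have hX : CoeffBound 1 (max 1 V) (X : PowerSeries K) := by
    have := coeffBound_C_mul_X_pow (x := (1 : K)) (m := 1) (c := 1) (V := max 1 V) (by simp)
      zero_le_one (by positivity)
    simpa using this
  simpa using hX.mul (h.mono_right hV (le_max_right 1 V)) (by positivity)

/-- A square root of `1 - β X ^ 2` with controlled coefficients. -/
lemma exists_sqrt_one_sub (hp2 : p ≠ 2) (β : K) {V : ℝ} (hV : 0 ≤ V) (hβ : ‖β‖ = V ^ 2) :
    ∃ σ : PowerSeries K, σ ^ 2 = 1 - C β * X ^ 2 ∧ coeff 0 σ = 1 ∧ CoeffBound 1 V σ ∧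
      ∀ n, 2 * n < p → ‖coeff (2 * n + 2) σ‖ = V ^ (2 * n + 2) := by
  have hp2' : ¬ p ∣ 2 := fun hd =>
    hp2 ((Nat.prime_dvd_prime_iff_eq hp.out Nat.prime_two).1 hd)
  have h2 : ‖(2 : K)‖ = 1 := by exact_mod_cast norm_natCast_eq_one_of_not_dvd (K := K) hp2'
  have h2ne : (2 : K) ≠ 0 := by rw [← norm_pos_iff, h2]; exact one_pos
  set γ := β / 4 with hγ
  have h4 : (4 : K) = 2 * 2 := by norm_num
  have hγn : ‖γ‖ = V ^ 2 := by rw [hγ, h4, norm_div, norm_mul, h2, hβ]; simp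
  have hγβ : 4 * γ = β := by
    rw [hγ, mul_div_cancel₀]; rw [h4]; exact mul_ne_zero h2ne h2ne
  set c : PowerSeries K := expand 2 two_ne_zero
    (rescale γ (map (Nat.castRingHom K) catalanSeries)) with hc
  have hcoeff : ∀ n, coeff (2 * n) c = γ ^ n * (catalan n : K) := by
    intro n
    rw [hc, coeff_expand_mul, coeff_rescale, coeff_map, catalanSeries_coeff]; rfl
  have hcb : CoeffBound 1 V c := by
    intro k
    by_cases hk : 2 ∣ k
    · obtain ⟨n, rfl⟩ := hk
      rw [hcoeff, norm_mul, norm_pow, hγn, ← pow_mul, one_mul]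
      exact mul_le_of_le_one_right (by positivity) (IsUltrametricDist.norm_natCast_le_one K _)
    · rw [hc, coeff_expand_of_not_dvd 2 _ _ hk, norm_zero]; positivity
  have hceq : c ^ 2 * (C γ * X ^ 2) + 1 = c := by
    have h := congrArg (fun s => expand 2 two_ne_zero
      (rescale γ (map (Nat.castRingHom K) s))) catalanSeries_sq_mul_X_add_one
    simp only [map_add, map_mul, map_pow, map_one, map_X, rescale_X, expand_C, expand_X] at h
    exact h
  have hC4 : (C β : PowerSeries K) = 4 * C γ := by rw [← hγβ, map_mul]; rfl
  -- With `c(t)` the Catalan series, `√(1 - 4 t) = 1 - 2 t c(t)`; here `t = γ X ^ 2` and `4 γ = β`.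
  refine ⟨1 - C (2 * γ) * X ^ 2 * c, ?_, ?_, ?_, ?_⟩
  · rw [map_mul, show (C 2 : PowerSeries K) = 2 from rfl, hC4]
    linear_combination (4 * C γ * X ^ 2) * hceq
  · rw [map_sub, coeff_zero_mul, coeff_zero_mul]; simp
  · refine (coeffBound_one hV).sub ?_
    have : CoeffBound 1 V (C (2 * γ) * X ^ 2) :=
      coeffBound_C_mul_X_pow (by rw [norm_mul, h2, hγn]) zero_le_one hV
    simpa using this.mul hcb hV
  · intro n hn
    rw [map_sub, coeff_one, if_neg (by omega), zero_sub, norm_neg, mul_assoc, coeff_C_mul,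
      coeff_X_pow_mul, hcoeff, norm_mul, norm_mul, norm_mul, norm_pow, h2, hγn,
      norm_catalan_eq_one hn]
    ring

theorem not_isLocallyLinearizable_of_dominant_resonance (hp5 : 5 ≤ p) {f psi r : PowerSeries K} {L : K} {mu V W : ℝ} (hf0 : coeff 0 f = 0)
    (hf1 : coeff 1 f = L) (hL : L ≠ 1) (hV : 0 < V) (hmu : ‖L - 1‖ ≤ mu) (hmu1 : mu < 1)
    (hpsi0 : coeff 0 psi = 0) (hpsi1 : coeff 1 psi = 1) (hW : 0 < W) (hpsi : CoeffBound 1 W psi)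
    (hconj : psi.subst (twist L r) = f.subst psi) (hr0 : coeff 0 r = 0)
    (hr : CoeffBound (‖L - 1‖ * mu) V r)
    (hdom : ‖coeff p r‖ = ‖L - 1‖ * mu * V ^ p ∨
      ‖coeff (p * 2) r‖ = ‖L - 1‖ * mu * V ^ (p * 2) ∧ mu = ‖L - 1‖) :
    ¬ IsLocallyLinearizable f := by
  intro hlin
  obtain ⟨h, h0, h1, han, heq⟩ := hlin.exists_linearization hf0
  rw [hf1] at heq
  have hL1 := hmu.trans_lt hmu1
  have hL0 : L ≠ 0 := by
    rw [← norm_pos_iff, norm_eq_one_of_norm_sub_one_lt hL1]; exact one_pos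
  obtain ⟨D, hD, hh⟩ := han.exists_pow_bound h0 (sub_ne_zero.2 hL) hL1
  obtain ⟨u, B, hu0, hu, hueq⟩ := exists_cohomological_solution hL0 hf0 h0 h1 heq hD hh hpsi0 hpsi1
    hW hpsi hconj
  exact false_of_dominant_resonance hp5 hL hV hmu hmu1 hr0 hr hdom hu0 hu hueq

end Cubic

end PowerSeries

/-! ### Cubics with dominant quadratic term -/

namespace PowerSeries

section Cases

variable {K : Type*} [NormedField K] [IsUltrametricDist K] {p : ℕ} [hp : Fact p.Prime] [CharP K p]

lemma norm_coeff_eq_of_coeffBound {a b : PowerSeries K} {c d V : ℝ} (h : CoeffBound c V (a - b))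
    (hV : 0 < V) (hcd : c < d) {k : ℕ} (hb : ‖coeff k b‖ = d * V ^ k) :
    ‖coeff k a‖ = d * V ^ k := by
  rw [← hb]
  refine norm_eq_of_norm_sub_lt ?_
  rw [← map_sub, hb]
  exact (h k).trans_lt (mul_lt_mul_of_pos_right hcd (by positivity))

/-- The case where the quadratic term of `cubic ε α β` dominates. -/
theorem not_isLocallyLinearizable_cubic_of_quadratic (hp5 : 5 ≤ p) {ε α β : K} {mu : ℝ}
    (hε : ε ≠ 0) (hα : α ≠ 0) (hmu : ‖ε‖ ≤ mu) (hmu1 : mu < 1) (hβ : ‖β‖ ≤ mu * ‖α‖ ^ 2)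
    (hres : ‖β - ε * α ^ 2‖ = mu * ‖α‖ ^ 2) : ¬ IsLocallyLinearizable (cubic ε α β) := by
  set V := ‖α‖ with hVdef
  have hV : 0 < V := norm_pos_iff.2 hα
  have he : 0 < ‖ε‖ := norm_pos_iff.2 hε
  have hmu0 : 0 < mu := he.trans_le hmu
  have he1 : ‖ε‖ < 1 := hmu.trans_lt hmu1
  set L := 1 + ε with hL
  have hLe : L - 1 = ε := by rw [hL]; ring
  have hL1 : L ≠ 1 := by rw [← sub_ne_zero, hLe]; exact hε
  have hLn : ‖L‖ = 1 := norm_eq_one_of_norm_sub_one_lt (by rwa [hLe])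
  have hL0 : L ≠ 0 := by rw [← norm_pos_iff, hLn]; exact one_pos
  set P : PowerSeries K := C α * X with hP
  set Q : PowerSeries K := C β * X ^ 2 with hQ
  have hPb : CoeffBound 1 V P := by
    have := coeffBound_C_mul_X_pow (x := α) (m := 1) (c := 1) (V := V) (by simp [hVdef])
      zero_le_one hV.le
    simpa using this
  have hQb : CoeffBound mu V Q := coeffBound_C_mul_X_pow hβ hmu0.le hV.le
  -- the geometric series
  set φ : PowerSeries K := mk fun k => α ^ k with hφ
  have hφc : ∀ k, coeff k φ = α ^ k := fun k => by rw [hφ, coeff_mk]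
  have hφb : CoeffBound 1 V φ := fun k => by rw [hφc, norm_pow, one_mul]
  have hφ0 : coeff 0 φ = 1 := by rw [hφc, pow_zero]
  have hφP : φ = 1 + P * φ := by
    ext k
    rw [map_add, hP, mul_assoc, coeff_C_mul, hφc, coeff_one]
    cases k with
    | zero => simp
    | succ k => rw [coeff_succ_X_mul, hφc, if_neg (by omega), pow_succ]; ring
  have hφne : φ ≠ 0 := fun h => by rw [h] at hφ0; simp at hφ0
  -- `X / (1 - α X)` linearizes the vector field `z (1 + α z)`.
  set psi := X * φ with hpsi
  have hpsi0 : coeff 0 psi = 0 := by rw [hpsi, coeff_zero_mul, coeff_zero_X, zero_mul]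
  have hpsi1 : coeff 1 psi = 1 := by rw [hpsi, coeff_succ_X_mul, hφ0]
  set A := 1 + C α * psi + C β * psi ^ 2 with hA
  have hA' : A = φ + Q * φ ^ 2 := by
    rw [hP] at hφP
    rw [hA, hpsi, hQ]
    linear_combination -hφP
  have hAb : CoeffBound 1 V A := by
    rw [hA']
    refine hφb.add ?_
    have := hQb.mul (hφb.pow hV.le 2) hV.le
    exact this.mono (by simpa using hmu1.le) hV.le
  set g := psi * (1 + C ε * A) with hg
  have hg0 : coeff 0 g = 0 := by rw [hg, coeff_zero_mul, hpsi0, zero_mul]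
  have hA0 : coeff 0 A = 1 := by
    rw [hA', map_add, coeff_zero_mul, hφ0, hQ, coeff_zero_mul]; simp
  have hg1 : coeff 1 g = L := by
    rw [hg, hpsi, mul_assoc, coeff_succ_X_mul, coeff_zero_mul, hφ0, one_mul, map_add, coeff_C_mul,
      hA0, coeff_zero_one, mul_one]
  obtain ⟨r, hr0, hr⟩ := exists_subst_twist_eq hL0 hpsi0 hpsi1 hg0 hg1
  have hsub : g * (1 - C α * twist L r) = twist L r :=
    subst_mul_one_sub (hasSubst_twist L r) hr (by rw [hpsi]; linear_combination X * hφP)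
  have hCL : (C L : PowerSeries K) = 1 + C ε := by rw [hL, map_add, map_one]
  set D := C L * (1 + C ε * P * A) with hD
  have hDr : D * r = C ε * (Q * φ - C ε * P * A) := by
    have h1 : X * φ * ((C L * (1 + r)) * (1 + C ε * P * A)) = X * φ * (1 + C ε * A) := by
      rw [twist] at hsub
      rw [hg, hpsi] at hsub
      rw [hP] at hφP ⊢
      linear_combination -hsub + (C L * X * (1 + r)) * hφP
    have h2 := mul_left_cancel₀ (mul_ne_zero X_ne_zero hφne) h1
    rw [hD, hCL]
    rw [hCL] at h2
    linear_combination h2 + C ε * (1 - P) * hA' + C ε * (1 + Q * φ) * hφP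
  have hεb : CoeffBound ‖ε‖ V (C ε : PowerSeries K) := coeffBound_C hV.le ε
  have hPA : CoeffBound 1 V (P * A) := by simpa using hPb.mul hAb hV.le
  have hDb : CoeffBound ‖ε‖ V (1 - D) := by
    have h1 : 1 - D = C ε * (-1 - C L * (P * A)) := by rw [hD, hCL]; ring
    have h2 : CoeffBound 1 V (C L * (P * A)) := by simpa [hLn] using hPA.C_mul L
    rw [h1]
    simpa using (((coeffBound_one hV.le).neg).sub h2).C_mul ε
  have hD1 : CoeffBound 1 V D := by
    have := (coeffBound_one hV.le).sub (hDb.mono he1.le hV.le)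
    simpa using this
  have hD0 : ‖coeff 0 D‖ = 1 := by
    refine norm_eq_one_of_norm_sub_one_lt ?_
    rw [norm_sub_rev]
    have := hDb 0
    rw [map_sub, coeff_zero_one, pow_zero, mul_one] at this
    exact this.trans_lt he1
  have hQφ : CoeffBound mu V (Q * φ) := by simpa using hQb.mul hφb hV.le
  have hN : CoeffBound mu V (Q * φ - C ε * P * A) := by
    refine hQφ.sub ?_
    rw [mul_assoc]
    exact (hPA.C_mul ε).mono (by simpa using hmu) hV.le
  have hrb : CoeffBound (‖ε‖ * mu) V r :=
    CoeffBound.of_mul hV.le hD1 hD0 (by rw [hDr]; exact hN.C_mul ε)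
  -- the leading part of `r`
  have hlead : CoeffBound (‖ε‖ * mu * ‖ε‖) V (r - C ε * (Q * φ - C ε * (P * φ))) := by
    have h1 : r - C ε * (Q * φ - C ε * (P * φ)) =
        r * (1 - D) - C ε * (C ε * (P * (Q * φ ^ 2))) := by
      linear_combination hDr - C ε * C ε * P * hA'
    rw [h1]
    refine (hrb.mul hDb hV.le).sub ?_
    have h2 : CoeffBound mu V (P * (Q * φ ^ 2)) := by
      simpa using hPb.mul (hQb.mul (hφb.pow hV.le 2) hV.le) hV.le
    exact ((h2.C_mul ε).C_mul ε).mono (by apply le_of_eq; ring) hV.le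
  have hcp : ‖coeff p (C ε * (Q * φ - C ε * (P * φ)))‖ = ‖ε‖ * mu * V ^ p := by
    obtain ⟨m, rfl⟩ : ∃ m, p = m + 2 := ⟨p - 2, by omega⟩
    -- The coefficient where `β - ε α ^ 2`, the quantity of known norm, appears.
    have h1 : coeff (m + 2) (C ε * (Q * φ - C ε * (P * φ))) =
        ε * (α ^ m * (β - ε * α ^ 2)) := by
      rw [coeff_C_mul, map_sub, coeff_C_mul, hQ, hP, mul_assoc, mul_assoc, coeff_C_mul,
        coeff_C_mul, coeff_X_pow_mul, coeff_succ_X_mul, hφc, hφc]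
      ring
    rw [h1, norm_mul, norm_mul, norm_pow, hres]
    ring
  have hrp : ‖coeff p r‖ = ‖ε‖ * mu * V ^ p :=
    norm_coeff_eq_of_coeffBound hlead hV (mul_lt_of_lt_one_right (by positivity) he1) hcp
  refine not_isLocallyLinearizable_of_dominant_resonance (p := p) hp5 (coeff_zero_cubic ε α β)
    (coeff_one_cubic ε α β) hL1 hV (by rwa [hLe]) hmu1 hpsi0 hpsi1
    (show (0 : ℝ) < max 1 V by positivity) (hφb.X_mul hV.le) ?_ hr0 (by rwa [hLe])
    (Or.inl (by rwa [hLe]))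
  rw [subst_cubic hpsi0]
  exact hr

end Cases

end PowerSeries

/-! ### Cubics with dominant cubic term -/

namespace PowerSeries

section CubicCase

variable {K : Type*} [NormedField K] [IsUltrametricDist K] {p : ℕ} [hp : Fact p.Prime] [CharP K p]

/-- Expansion of the squared conjugacy equation in powers of `e`: the first bracket is the leading
part, the rest is smaller by the factor `‖ε‖` in the application. -/
lemma conjugation_identity {R : Type*} [CommRing R] {e P Q A φ σ : R} (hS : φ ^ 2 * (1 - Q) = 1)
    (hφQ : φ * (1 - Q) = σ) (hA : A = φ ^ 2 + P * φ) :
    (1 + e * A) ^ 2 - (1 + e) ^ 2 * (1 + e * (Q * (2 * A + e * A ^ 2))) =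
      e * ((2 * (P * σ) - e * (3 * (φ ^ 2 - 1))) +
        (e * (P * (φ + A * σ - 4 * Q * φ)) - e * (e * (Q * (2 * A + 2 * A ^ 2))) -
          e * (e * (e * (Q * A ^ 2))))) := by
  have r2 : A * (1 - Q) = 1 + P * σ := by
    linear_combination (1 - Q) * hA + hS + P * hφQ
  linear_combination (2 * e + e * e * A) * r2 + e * e * (1 - 4 * Q) * hA + 4 * e * e * hS

/-- Size and leading part of the solution of `M * (2 * r + r ^ 2) = ε * (N + E)`, where `M` is
close to `1` and `E` is smaller than `N`. -/
lemma coeffBound_of_quadratic_eq {ε : K} {M N E r : PowerSeries K} {mu V : ℝ} (hV : 0 ≤ V)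
    (he1 : ‖ε‖ < 1) (hmu0 : 0 ≤ mu) (hmu1 : mu < 1) (h2 : ‖(2 : K)‖ = 1) (hr0 : coeff 0 r = 0)
    (hM : CoeffBound ‖ε‖ V (1 - M)) (hN : CoeffBound mu V N) (hE : CoeffBound (‖ε‖ * mu) V E)
    (h : M * (2 * r + r ^ 2) = C ε * (N + E)) :
    CoeffBound (‖ε‖ * mu) V r ∧ CoeffBound (‖ε‖ * mu * ‖ε‖) V (C 2 * r - C ε * N) := by
  have he := norm_nonneg ε
  have hM1 : CoeffBound 1 V M := by
    simpa using (coeffBound_one hV).sub (hM.mono he1.le hV)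
  have hM0 : ‖coeff 0 M‖ = 1 := by
    refine norm_eq_one_of_norm_sub_one_lt ?_
    rw [norm_sub_rev]
    have := hM 0
    rw [map_sub, coeff_zero_one, pow_zero, mul_one] at this
    exact this.trans_lt he1
  have hNE : CoeffBound mu V (N + E) :=
    hN.add (hE.mono (mul_le_of_le_one_left hmu0 he1.le) hV)
  have heμ1 : ‖ε‖ * mu ≤ 1 := (mul_le_of_le_one_left hmu0 he1.le).trans hmu1.le
  have hρ : CoeffBound (‖ε‖ * mu) V (2 * r + r ^ 2) :=
    CoeffBound.of_mul hV hM1 hM0 (by rw [h]; exact hNE.C_mul ε)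
  have hr : CoeffBound (‖ε‖ * mu) V r := CoeffBound.of_two_mul_add_sq hV hr0 h2 heμ1 hρ
  refine ⟨hr, ?_⟩
  have h1 : C 2 * r - C ε * N = (2 * r + r ^ 2) * (1 - M) + C ε * E - r * r := by
    rw [show (C 2 : PowerSeries K) = 2 from rfl]; linear_combination h
  rw [h1]
  refine ((hρ.mul hM hV).add ?_).sub ?_
  · exact (hE.C_mul ε).mono (by apply le_of_eq; ring) hV
  · refine (hr.mul hr hV).mono ?_ hV
    gcongr
    exact mul_le_of_le_one_right he hmu1.le

/-- The case where the cubic term of `cubic ε α β` dominates. -/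
theorem not_isLocallyLinearizable_cubic_of_cubic (hp5 : 5 ≤ p) {ε α β : K}
    (hε : ε ≠ 0) (he1 : ‖ε‖ < 1) (hαβ : ‖α‖ ^ 2 < ‖β‖) :
    ¬ IsLocallyLinearizable (cubic ε α β) := by
  have hnc : ∀ n : ℕ, 0 < n → n < 5 → ‖(n : K)‖ = 1 := fun n h0 h5 =>
    norm_natCast_eq_one_of_not_dvd (p := p) fun hd => by
      have := Nat.le_of_dvd h0 hd
      omega
  have h2 : ‖(2 : K)‖ = 1 := by exact_mod_cast hnc 2 (by omega) (by omega)
  have h3 : ‖(3 : K)‖ = 1 := by exact_mod_cast hnc 3 (by omega) (by omega)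
  have hβ0 : 0 < ‖β‖ := (by positivity : (0 : ℝ) ≤ ‖α‖ ^ 2).trans_lt hαβ
  set V := Real.sqrt ‖β‖ with hVdef
  have hV : 0 < V := Real.sqrt_pos.2 hβ0
  have hβV : ‖β‖ = V ^ 2 := (Real.sq_sqrt hβ0.le).symm
  have he : 0 < ‖ε‖ := norm_pos_iff.2 hε
  -- `η` measures the quadratic term at the natural scale `V = √‖β‖` of the cubic one.
  set η := ‖α‖ / V with hη
  have hη0 : 0 ≤ η := by positivity
  have hαη : ‖α‖ = η * V := by rw [hη, div_mul_cancel₀ _ hV.ne']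
  have hη1 : η < 1 := by
    rw [hη, div_lt_one hV]
    rw [hβV] at hαβ
    exact lt_of_pow_lt_pow_left₀ 2 hV.le hαβ
  set mu := max η ‖ε‖ with hmu
  have hmu0 : 0 < mu := lt_max_of_lt_right he
  have hmu1 : mu < 1 := max_lt hη1 he1
  have hημ : η ≤ mu := le_max_left _ _
  have heμ : ‖ε‖ ≤ mu := le_max_right _ _
  set L := 1 + ε with hL
  have hLe : L - 1 = ε := by rw [hL]; ring
  have hL1 : L ≠ 1 := by rw [← sub_ne_zero, hLe]; exact hε
  have hLn : ‖L‖ = 1 := norm_eq_one_of_norm_sub_one_lt (by rwa [hLe])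
  have hL0 : L ≠ 0 := by rw [← norm_pos_iff, hLn]; exact one_pos
  set P : PowerSeries K := C α * X with hP
  set Q : PowerSeries K := C β * X ^ 2 with hQ
  have hPb : CoeffBound η V P := by
    have := coeffBound_C_mul_X_pow (x := α) (m := 1) (c := η) (V := V) (by rw [pow_one, hαη])
      hη0 hV.le
    simpa using this
  have hQb : CoeffBound 1 V Q := coeffBound_C_mul_X_pow (by rw [one_mul, hβV]) zero_le_one hV.le
  obtain ⟨σ, hσ2, hσ0, hσb, hσc⟩ := exists_sqrt_one_sub (p := p) (by omega) β hV.le hβV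
  have hσφ : σ * σ⁻¹ = 1 := PowerSeries.mul_inv_cancel σ (by
    rw [← coeff_zero_eq_constantCoeff_apply, hσ0]; exact one_ne_zero)
  set φ := σ⁻¹
  have hφb : CoeffBound 1 V φ := by
    refine CoeffBound.of_mul hV.le hσb (by rw [hσ0, norm_one]) ?_
    rw [hσφ]; exact coeffBound_one hV.le
  have hφ0 : coeff 0 φ = 1 := by
    have := congrArg (coeff 0) hσφ
    rwa [coeff_zero_mul, hσ0, one_mul, coeff_zero_one] at this
  have hφne : φ ≠ 0 := fun h => by rw [h] at hφ0; simp at hφ0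
  have hS : φ ^ 2 * (1 - Q) = 1 := by
    linear_combination -φ ^ 2 * hσ2 + (σ * φ + 1) * hσφ
  have hφQ : φ * (1 - Q) = σ := by linear_combination -φ * hσ2 + σ * hσφ
  -- `X / √(1 - β X ^ 2)` linearizes the vector field `z (1 + β z ^ 2)`.
  set psi := X * φ with hpsi
  have hpsi0 : coeff 0 psi = 0 := by rw [hpsi, coeff_zero_mul, coeff_zero_X, zero_mul]
  have hpsi1 : coeff 1 psi = 1 := by rw [hpsi, coeff_succ_X_mul, hφ0]
  set A := 1 + C α * psi + C β * psi ^ 2 with hA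
  have hA' : A = φ ^ 2 + P * φ := by
    rw [hQ] at hS
    rw [hA, hpsi, hP]
    linear_combination -hS
  have hφ2 : CoeffBound 1 V (φ ^ 2) := hφb.pow hV.le 2
  have hPφ : CoeffBound η V (P * φ) := by simpa using hPb.mul hφb hV.le
  have hAb : CoeffBound 1 V A := by
    rw [hA']; exact hφ2.add (hPφ.mono hη1.le hV.le)
  set g := psi * (1 + C ε * A) with hg
  have hg0 : coeff 0 g = 0 := by rw [hg, coeff_zero_mul, hpsi0, zero_mul]
  have hA0 : coeff 0 A = 1 := by
    rw [hA', map_add, pow_two, coeff_zero_mul, hφ0, hP, coeff_zero_mul]; simp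
  have hg1 : coeff 1 g = L := by
    rw [hg, hpsi, mul_assoc, coeff_succ_X_mul, coeff_zero_mul, hφ0, one_mul, map_add, coeff_C_mul,
      hA0, coeff_zero_one, mul_one]
  obtain ⟨r, hr0, hr⟩ := exists_subst_twist_eq hL0 hpsi0 hpsi1 hg0 hg1
  have hsub : g ^ 2 * (1 - C β * twist L r ^ 2) = twist L r ^ 2 :=
    sq_mul_subst_one_sub (hasSubst_twist L r) hr (by rw [hpsi]; linear_combination X ^ 2 * hS)
  have hCL : (C L : PowerSeries K) = 1 + C ε := by rw [hL, map_add, map_one]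
  set T := 2 * A + C ε * A ^ 2 with hT
  set M := C L ^ 2 * (1 + C ε * (Q * T)) with hM
  set N0 := 2 * (P * σ) - C ε * (3 * (φ ^ 2 - 1)) with hN0
  set E := C ε * (P * (φ + A * σ - 4 * Q * φ)) - C ε * (C ε * (Q * (2 * A + 2 * A ^ 2)))
    - C ε * (C ε * (C ε * (Q * A ^ 2))) with hE
  have hMr : M * (2 * r + r ^ 2) = C ε * (N0 + E) := by
    have h1 : (X * φ) ^ 2 * ((C L * (1 + r)) ^ 2 * (1 + C ε * (Q * T))) =
        (X * φ) ^ 2 * (1 + C ε * A) ^ 2 := by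
      rw [twist, hg, hpsi] at hsub
      rw [hT]
      rw [hQ] at hS ⊢
      linear_combination -hsub + (C L * X * (1 + r)) ^ 2 * hS
    have h4 := mul_left_cancel₀ (pow_ne_zero 2 (mul_ne_zero X_ne_zero hφne)) h1
    have h5 : (1 + C ε * A) ^ 2 - M = C ε * (N0 + E) := by
      rw [hM, hN0, hE, hT, hCL]
      exact conjugation_identity hS hφQ hA'
    rw [← h5, hM]
    linear_combination h4
  have hC2 : (2 : PowerSeries K) = C 2 := rfl
  have hC3 : (3 : PowerSeries K) = C 3 := rfl
  clear_value E N0 M T A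
  have hnat : ∀ (n : ℕ) {c : ℝ} {a : PowerSeries K}, CoeffBound c V a →
      CoeffBound c V ((n : PowerSeries K) * a) := by
    intro n c a ha k
    rw [← map_natCast (C : K →+* PowerSeries K), coeff_C_mul, norm_mul]
    exact (mul_le_of_le_one_left (norm_nonneg _) (IsUltrametricDist.norm_natCast_le_one K n)).trans
      (ha k)
  have hA2 : CoeffBound 1 V (A ^ 2) := hAb.pow hV.le 2
  have hTb : CoeffBound 1 V T := by
    rw [hT]
    refine CoeffBound.add (by exact_mod_cast hnat 2 hAb) ?_
    exact (hA2.C_mul ε).mono (by simpa using he1.le) hV.le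
  have hQT : CoeffBound 1 V (Q * T) := by simpa using hQb.mul hTb hV.le
  have hMb : CoeffBound ‖ε‖ V (1 - M) := by
    have h1 : 1 - M = C ε * (-(C (2 + ε) * 1) - C (L ^ 2) * (Q * T)) := by
      rw [hM, map_pow, hCL, map_add, ← hC2]; ring
    have h4 : CoeffBound 1 V (C (L ^ 2) * (Q * T)) :=
      (hQT.C_mul (L ^ 2)).mono (by rw [norm_pow, hLn, one_pow, one_mul]) hV.le
    have h5 : ‖2 + ε‖ ≤ 1 := norm_add_le_of_le h2.le he1.le
    have h6 : CoeffBound 1 V (C (2 + ε) * 1) :=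
      ((coeffBound_one hV.le).C_mul (2 + ε)).mono (by simpa using h5) hV.le
    rw [h1]
    simpa using (h6.neg.sub h4).C_mul ε
  have hEb : CoeffBound (‖ε‖ * mu) V E := by
    have hx : CoeffBound 1 V (φ + A * σ - 4 * Q * φ) := by
      refine (hφb.add (by simpa using hAb.mul hσb hV.le)).sub ?_
      rw [mul_assoc]
      exact_mod_cast hnat 4 (by simpa using hQb.mul hφb hV.le)
    have hy : CoeffBound 1 V (Q * (2 * A + 2 * A ^ 2)) := by
      have : CoeffBound 1 V (2 * A + 2 * A ^ 2) :=
        CoeffBound.add (by exact_mod_cast hnat 2 hAb) (by exact_mod_cast hnat 2 hA2)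
      simpa using hQb.mul this hV.le
    have hz : CoeffBound 1 V (Q * A ^ 2) := by simpa using hQb.mul hA2 hV.le
    rw [hE]
    refine CoeffBound.sub (CoeffBound.sub ?_ ?_) ?_
    · exact ((hPb.mul hx hV.le).C_mul ε).mono (by rw [mul_one]; gcongr) hV.le
    · exact ((hy.C_mul ε).C_mul ε).mono (by rw [mul_one]; gcongr) hV.le
    · refine (((hz.C_mul ε).C_mul ε).C_mul ε).mono ?_ hV.le
      rw [mul_one]
      gcongr
      exact (mul_le_of_le_one_left he.le he1.le).trans heμ
  have hφ21 : CoeffBound 1 V (φ ^ 2 - 1) := hφ2.sub (coeffBound_one hV.le)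
  have hN0b : CoeffBound mu V N0 := by
    rw [hN0]
    refine CoeffBound.sub ?_ ?_
    · have : CoeffBound η V (P * σ) := by simpa using hPb.mul hσb hV.le
      exact CoeffBound.mono (by exact_mod_cast hnat 2 this) hημ hV.le
    · have : CoeffBound 1 V (3 * (φ ^ 2 - 1)) := by exact_mod_cast hnat 3 hφ21
      exact (this.C_mul ε).mono (by simpa using heμ) hV.le
  obtain ⟨hrb, hlead⟩ := coeffBound_of_quadratic_eq hV.le he1 hmu0.le hmu1 h2 hr0 hMb hN0b hEb hMr
  have hlt : ‖ε‖ * mu * ‖ε‖ < ‖ε‖ * mu := mul_lt_of_lt_one_right (by positivity) he1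
  have hrk : ∀ k, ‖coeff k N0‖ = mu * V ^ k → ‖coeff k r‖ = ‖ε‖ * mu * V ^ k := by
    intro k hk
    have h1 := norm_coeff_eq_of_coeffBound hlead hV hlt (k := k) (by
      rw [coeff_C_mul, norm_mul, hk, mul_assoc])
    rwa [coeff_C_mul, norm_mul, h2, one_mul] at h1
  have hN0c : ∀ k, coeff (k + 1) N0 = 2 * (α * coeff k σ) - ε * (3 * coeff (k + 1) (φ ^ 2)) := by
    intro k
    rw [hN0, hC2, hC3, hP, map_sub, coeff_C_mul, coeff_C_mul, coeff_C_mul, mul_assoc, coeff_C_mul,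
      coeff_succ_X_mul, map_sub, coeff_one, if_neg (by omega), sub_zero]
  have hodd : ∃ m, p = 2 * m + 3 := by
    obtain ⟨s, hs⟩ := hp.out.odd_of_ne_two (by omega)
    exact ⟨s - 1, by omega⟩
  -- In odd degrees `N0` is governed by `α σ`, and a Catalan number prime to `p` makes degree `p`
  -- maximal. If `η < ‖ε‖`, the term `-3 ε β ^ p` in degree `2 p` is maximal instead.
  have hdom : ‖coeff p r‖ = ‖ε‖ * mu * V ^ p ∨
      ‖coeff (p * 2) r‖ = ‖ε‖ * mu * V ^ (p * 2) ∧ mu = ‖ε‖ := by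
    rcases le_or_gt ‖ε‖ η with hc | hc
    · left
      refine hrk p ?_
      obtain ⟨m, hm⟩ := hodd
      have h1 : coeff p N0 = 2 * (α * coeff (2 * m + 2) σ) := by
        rw [hm, hN0c, show 2 * m + 2 + 1 = 2 * (m + 1) + 1 by ring, (coeff_geometric_sq hS _).2]
        ring
      rw [h1, norm_mul, norm_mul, h2, hσc m (by omega), hαη, hmu, max_eq_left hc, hm]
      ring
    · right
      have hmue : mu = ‖ε‖ := by rw [hmu, max_eq_right hc.le]
      refine ⟨hrk _ ?_, hmue⟩
      obtain ⟨k, hk⟩ : ∃ k, p * 2 = k + 1 := ⟨p * 2 - 1, by omega⟩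
      have hb : ‖ε * (3 * coeff (k + 1) (φ ^ 2))‖ = mu * V ^ (k + 1) := by
        rw [← hk, mul_comm p 2, (coeff_geometric_sq hS _).1, norm_mul, norm_mul, norm_pow, h3,
          hβV, hmue]
        ring
      rw [hk, hN0c, ← hb, ← norm_neg (ε * _)]
      refine norm_eq_of_norm_sub_lt ?_
      rw [norm_neg, hb, sub_neg_eq_add, sub_add_cancel, norm_mul, norm_mul, h2, hαη, hmue, one_mul]
      calc η * V * ‖coeff k σ‖ ≤ η * V * (1 * V ^ k) := by gcongr; exact hσb k
        _ = η * V ^ (k + 1) := by ring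
        _ < _ := mul_lt_mul_of_pos_right hc (by positivity)
  refine not_isLocallyLinearizable_of_dominant_resonance (p := p) hp5 (coeff_zero_cubic ε α β)
    (coeff_one_cubic ε α β) hL1 hV (by rwa [hLe]) hmu1 hpsi0 hpsi1
    (show (0 : ℝ) < max 1 V by positivity) (hφb.X_mul hV.le) ?_ hr0 (by rwa [hLe]) (by rwa [hLe])
  rw [subst_cubic hpsi0, ← hA]
  exact hr

end CubicCase

end PowerSeries

/-! ### Reduction to the two cubic cases -/

theorem theorem1p6 {K : Type*} [NormedField K] [IsUltrametricDist K] [CompleteSpace K]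
    (p : ℕ) (hp : p.Prime) [CharP K p] (hp5 : 5 ≤ p)
    (lam a₁ a₂ : K)
    (hlam : ∀ n : ℕ, 0 < n → lam ^ n ≠ 1)
    (hlam1 : ‖1 - lam‖ < 1)
    (ha₁ : a₁ ≠ 0)
    (hge : 1 ≤ ‖1 - a₂ / a₁ ^ 2‖)
    (hne : ‖1 - a₂ / a₁ ^ 2‖ ≠ 1 / ‖1 - lam‖) :
    ¬ IsLocallyLinearizable
      (PowerSeries.C lam * PowerSeries.X + PowerSeries.C a₁ * PowerSeries.X ^ 2 +
        PowerSeries.C a₂ * PowerSeries.X ^ 3) := by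
  have : Fact p.Prime := ⟨hp⟩
  have hε : lam - 1 ≠ 0 := sub_ne_zero.2 (by simpa using hlam 1 one_pos)
  obtain ⟨ε, rfl⟩ : ∃ ε, lam = 1 + ε := ⟨lam - 1, by ring⟩
  rw [add_sub_cancel_left] at hε
  obtain ⟨α, rfl⟩ : ∃ α, a₁ = ε * α := ⟨a₁ / ε, by field_simp⟩
  obtain ⟨β, rfl⟩ : ∃ β, a₂ = ε * β := ⟨a₂ / ε, by field_simp⟩
  have hα : α ≠ 0 := right_ne_zero_of_mul ha₁
  have he : 0 < ‖ε‖ := norm_pos_iff.2 hε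
  have hαn : 0 < ‖α‖ := norm_pos_iff.2 hα
  have hn : ‖1 - (1 + ε)‖ = ‖ε‖ := by rw [← norm_neg]; congr 1; ring
  rw [hn] at hlam1 hne
  have hres : ‖β - ε * α ^ 2‖ = ‖ε‖ * ‖1 - ε * β / (ε * α) ^ 2‖ * ‖α‖ ^ 2 := by
    rw [← norm_pow, ← norm_mul, ← norm_mul, ← norm_neg]
    congr 1
    field_simp
    ring
  have ha : ‖ε * β / (ε * α) ^ 2‖ ≤ ‖1 - ε * β / (ε * α) ^ 2‖ := by
    have := PowerSeries.norm_sub_le_of_le (x := 1) (y := 1 - ε * β / (ε * α) ^ 2)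
      (B := ‖1 - ε * β / (ε * α) ^ 2‖) (by rwa [norm_one]) le_rfl
    rwa [sub_sub_cancel] at this
  have hβ : ‖β‖ = ‖ε‖ * ‖ε * β / (ε * α) ^ 2‖ * ‖α‖ ^ 2 := by
    rw [← norm_pow, ← norm_mul, ← norm_mul]
    congr 1
    field_simp
  set R := ‖1 - ε * β / (ε * α) ^ 2‖
  -- By `hres`, `‖ε‖ * R` is the size of `β - ε α ^ 2` relative to `α ^ 2`. Below 1 it serves as
  -- `mu`; above 1 it forces `‖α‖ ^ 2 < ‖β‖`.
  rcases lt_trichotomy (‖ε‖ * R) 1 with h | h | h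
  · refine PowerSeries.not_isLocallyLinearizable_cubic_of_quadratic (p := p) hp5 (mu := ‖ε‖ * R)
      hε hα (le_mul_of_one_le_right he.le hge) h ?_ hres
    rw [hβ]
    gcongr
  · exact absurd (by rw [eq_div_iff he.ne', mul_comm]; exact h) hne
  · refine PowerSeries.not_isLocallyLinearizable_cubic_of_cubic (p := p) hp5 hε hlam1 ?_
    have hβR : ‖β‖ = ‖ε‖ * R * ‖α‖ ^ 2 := by
      rw [← hres, eq_comm]
      have hlt : ‖ε * α ^ 2‖ < ‖β - ε * α ^ 2‖ := by
        rw [hres, norm_mul, norm_pow]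
        refine mul_lt_mul_of_pos_right (hlam1.trans h) (by positivity)
      have := PowerSeries.norm_eq_of_norm_sub_lt (x := β) (y := β - ε * α ^ 2) (by
        rwa [sub_sub_cancel])
      exact this.symm
    rw [hβR]
    exact lt_mul_of_one_lt_left (by positivity) h
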